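/- Let $R$ be a commutative ring, $H$ a Hopf $R$-algebra that is projective as an $R$-module, with antipode $S$, and $A$ a unital $R$-algebra; write $\Delta(h)=\sum h_1\otimes h_2$ and $H^*=\mathrm{Hom}_R(H,R)$, an $R$-algebra under convolution $\star$ with unity $\varepsilon$. $H^*$ and $\mathrm{End}_R(H)$ carry the finite topology (induced from $R^H$, resp. $H^H$, with discrete factors); density refers to it. For $f\in H^*$, $k\in H$ put $f\rightharpoonup k=\sum k_1f(k_2)$, $k\leftharpoonup f=\sum f(k_1)k_2$ and $(kf)(h)=f(hk)$. A weak left $H$-action on $A$ is an $R$-linear map $H\otimes_R A\to A$, $h\otimes a\mapsto ha$, with $1_Ha=a$ such that $a\mapsto[h\mapsto ha]$ is an $R$-algebra morphism from $A$ to the convolution algebra $\mathrm{Hom}_R(H,A)$. Let such an action be given and let $\sigma:H\otimes_R H\to A$ be $R$-linear and convolution-invertible, with inverse $\sigma^{-1}$. Assume that $A\#_\sigma H:=A\otimes_R H$ with $$(a\#h)(\tilde a\#\tilde h)=\sum a(h_1\tilde a)\,\sigma(h_2\otimes\tilde h_1)\#h_3\tilde h_2$$ is associative with unity $1_A\#1_H$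 (that is, $A\#_\sigma H$ is a right $H$-crossed product with invertible cocycle). It is a right $H$-comodule algebra via $\mathrm{id}\otimes\Delta$. Let $U\subseteq H^*$ be a left $H$-module subalgebra: an $R$-submodule closed under $\star$ and under $f\mapsto hf$ ($h\in H$); it need not contain $\varepsilon$. For a right $H$-comodule algebra $B$, with coaction $b\mapsto\sum b_{<0>}\otimes b_{<1>}$, let $B\#^{op}U=B\otimes_R U$ with $$(b\#f)(\tilde b\#\tilde f)=\sum b_{<0>}\tilde b\#\big((b_{<1>}\tilde f)\star f\big),$$ which has unity $1_B\#\varepsilon$ if $\varepsilon\in U$. For an $R$-module $M$ and a submodule $W\subseteq H^*$ let $\alpha_M^W:M\otimes_R W\to\mathrm{Hom}_R(H,M)$, $m\otimes f\mapsto[h\mapsto f(h)m]$. Assume that there is an $R$-submodule $V\subseteq H^*$ such that $(V,U)$ is compatible, that is: (i) for all $h\in H$, $a\in A$ the maps $k\mapsto\sum(k_1a)\,\sigma(k_2\otimes h)$ and $k\mapsto\sum\sigma^{-1}(S(k_3)\otimes k_4)\,(S(k_2)a)\,\sigma(S(k_1)\otimes k_5h)$ lie in $\alpha_A^V(A\otimes_R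 V)$; (ii) for every $g\in V$ there are finitely many pairs $(h_j,g_j)\in H\times U$ with $k\leftharpoonup g=\sum_j(g_j\rightharpoonup k)h_j$ for all $k\in H$. Then: (1) If $U\subseteq H^*$ is dense and $\alpha_{A\otimes_R H}^U$ is injective, then there are a dense $R$-subalgebra $\mathcal L\subseteq\mathrm{End}_R(H)^{op}$ and an isomorphism of $R$-algebras $$(A\#_\sigma H)\#^{op}U\simeq A\otimes_R\mathcal L .$$ If $\varepsilon\in U$, then $\mathcal L$ contains $\mathrm{id}_H$ and the isomorphism preserves unities. (2) If $R$ is Noetherian and $U\subseteq R^H$ is $A$-pure (that is, $U\otimes_R A\to R^H\otimes_R A$ is injective), then $\alpha_{A\otimes_R H}^U$ is injective. (3) Suppose that $R$ is a QF ring (Noetherian and self-injective) and put $H^\circ=\{f\in H^*\mid HfH\text{ is a finitely generated }R\text{-module}\}$, where $(afb)(c)=f(bca)$. Suppose further that $H^\circ\subseteq R^H$ is a pure $R$-submodule ($H$ is a Hopf $\alpha$-algebra), that the canonical map $H\to H^{\circ*}$ is injective ($H$ is residually finite), and that $U\subseteq H^\circ$ is a dense $R$-subbialgebra (an $R$-submodule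 that is pure and dense in $H^\circ$, contains $\varepsilon$, is closed under $\star$, and satisfies: for each $f\in U$ there are finitely many $f_i',f_i''\in U$ with $f(hk)=\sum_i f_i'(h)f_i''(k)$ for all $h,k\in H$). Then $U\subseteq H^*$ is dense and $\alpha^U_{A\otimes_R H}$ is injective; hence the conclusion of (1) holds. -/

import Mathlib

open TensorProduct WithConv

namespace HopfDuality

universe u v w

noncomputable section

/-! ### Finite topology, purity, quasi-Frobenius rings -/

/-- The finite topology on `Hom_R(M, N)`: the topology induced from the product `N^M`
of discrete copies of `N`. -/
abbrev finiteTopology (R : Type*) [CommRing R] (M N : Type*) [AddCommGroup M] [Module R M]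
    [AddCommGroup N] [Module R N] : TopologicalSpace (M →ₗ[R] N) :=
  TopologicalSpace.induced (fun f : M →ₗ[R] N => (f : M → N))
    (@Pi.topologicalSpace M (fun _ => N) (fun _ => ⊥))

/-- `S` is dense in `T` (for `S ⊆ T`) with respect to the finite topology. -/
def IsDenseIn {R : Type*} [CommRing R] {M N : Type*} [AddCommGroup M] [Module R M]
    [AddCommGroup N] [Module R N] (S T : Set (M →ₗ[R] N)) : Prop :=
  T ⊆ @closure _ (finiteTopology R M N) S

/-- Density in the finite topology is approximation on finite sets. -/
theorem isDenseIn_iff {R : Type*} [CommRing R] {M N : Type*} [AddCommGroup M] [Module R M]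
    [AddCommGroup N] [Module R N] (S T : Set (M →ₗ[R] N)) :
    IsDenseIn S T ↔ ∀ f ∈ T, ∀ F : Finset M, ∃ g ∈ S, ∀ x ∈ F, g x = f x := by
  let _ : TopologicalSpace N := ⊥
  have : DiscreteTopology N := ⟨rfl⟩
  let _ : TopologicalSpace (M →ₗ[R] N) := finiteTopology R M N
  have hind : Topology.IsInducing (fun f : M →ₗ[R] N => (f : M → N)) := ⟨rfl⟩
  refine forall₂_congr fun f _ => ?_
  rw [show @closure _ (finiteTopology R M N) S = closure S from rfl,
    hind.closure_eq_preimage_closure_image, Set.mem_preimage, mem_closure_iff]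
  constructor
  · intro h F
    obtain ⟨-, hy, g, hg, rfl⟩ := h ((F : Set M).pi fun x => {f x})
      (isOpen_set_pi F.finite_toSet fun _ _ => isOpen_discrete _) (fun x _ => rfl)
    exact ⟨g, hg, fun x hx => hy x hx⟩
  · intro h o ho hf
    obtain ⟨F, W, hW, hsub⟩ := isOpen_pi_iff.1 ho f hf
    obtain ⟨g, hg, hgx⟩ := h F
    refine ⟨g, hsub fun x hx => ?_, g, hg, rfl⟩
    simpa only [hgx x hx] using (hW x hx).2

/-- A submodule `K` of `M`, given by its inclusion `i`, is `N`-pure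
if `K ⊗ N → M ⊗ N` is injective. -/
def IsPureFor {R : Type*} [CommRing R] {K M : Type*} [AddCommMonoid K] [Module R K]
    [AddCommMonoid M] [Module R M] (i : K →ₗ[R] M) (N : Type*) [AddCommGroup N] [Module R N] :
    Prop :=
  Function.Injective (i.rTensor N)

/-- Purity in the sense of Cohn. Since finitely presented modules are enough to test it, the
universe of the ring is big enough for the test modules. -/
def IsPure {R : Type u} [CommRing R] {K M : Type*} [AddCommMonoid K] [Module R K]
    [AddCommMonoid M] [Module R M] (i : K →ₗ[R] M) : Prop :=
  ∀ (N : Type u) [AddCommGroup N] [Module R N], IsPureFor i N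

/-- A commutative quasi-Frobenius ring: Noetherian and self-injective. -/
class IsQuasiFrobenius (R : Type u) [CommRing R] : Prop extends IsNoetherianRing R where
  selfInjective : Module.Injective R R

/-- The inclusion of a submodule `U ⊆ H*` into `R^H`. -/
def toFunctions {R : Type*} [CommRing R] {H : Type*} [AddCommGroup H] [Module R H]
    (U : Submodule R (Module.Dual R H)) : U →ₗ[R] (H → R) :=
  LinearMap.ltoFun R H R R ∘ₗ U.subtype

/-- The map `α_M : M ⊗ U → Hom_R(H, M)`, `m ⊗ f ↦ [h ↦ f(h) m]`, for `U ⊆ H*`. -/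
def alphaMap {R : Type*} [CommRing R] {H : Type*} [AddCommGroup H] [Module R H]
    (U : Submodule R (Module.Dual R H)) (M : Type*) [AddCommGroup M] [Module R M] :
    M ⊗[R] U →ₗ[R] (H →ₗ[R] M) :=
  dualTensorHom R H M ∘ₗ (TensorProduct.comm R M (Module.Dual R H)).toLinearMap ∘ₗ
    U.subtype.lTensor M

/-! ### Weak actions and crossed products -/

section Crossed

variable (R : Type u) (H : Type v) (A : Type w) [CommRing R] [Ring H] [HopfAlgebra R H]
  [Ring A] [Algebra R A]

/-- A weak left `H`-action on `A`: a linear map `h ⊗ a ↦ h a` such that `1_H a = a` and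
`a ↦ [h ↦ h a]` is a morphism of algebras from `A` to the convolution algebra `Hom_R(H, A)`. -/
structure WeakAction where
  act : H →ₗ[R] A →ₗ[R] A
  one_act : ∀ a : A, act 1 a = a
  act_one : toConv (act.flip 1) = (1 : WithConv (H →ₗ[R] A))
  act_mul : ∀ a b : A, toConv (act.flip (a * b)) = toConv (act.flip a) * toConv (act.flip b)

variable {R H A}

/-- The convolution-invertible linear maps `H ⊗ H → A`. -/
abbrev InvertibleCochain (R : Type u) (H : Type v) (A : Type w) [CommRing R] [Ring H]
    [HopfAlgebra R H] [Ring A] [Algebra R A] :=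
  (WithConv (H ⊗[R] H →ₗ[R] A))ˣ

/-- `σ` as a linear map `H ⊗ H → A`. -/
abbrev InvertibleCochain.map (σ : InvertibleCochain R H A) : H ⊗[R] H →ₗ[R] A :=
  (σ : WithConv (H ⊗[R] H →ₗ[R] A)).ofConv

/-- The convolution inverse of `σ` as a linear map `H ⊗ H → A`. -/
abbrev InvertibleCochain.invMap (σ : InvertibleCochain R H A) : H ⊗[R] H →ₗ[R] A :=
  ((σ⁻¹ : InvertibleCochain R H A) : WithConv (H ⊗[R] H →ₗ[R] A)).ofConv

variable (R H A) in
/-- Left multiplication on the first factor, `a ⊗ (b ⊗ h) ↦ ab ⊗ h`. -/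
def leftMul : A ⊗[R] (A ⊗[R] H) →ₗ[R] A ⊗[R] H :=
  (LinearMap.mul' R A).rTensor H ∘ₗ (TensorProduct.assoc R A A H).symm.toLinearMap

/-- `h ⊗ k ↦ ∑ σ(h₁ ⊗ k₁) ⊗ h₂ k₂`. -/
def cocycleMul (σ : H ⊗[R] H →ₗ[R] A) : H ⊗[R] H →ₗ[R] A ⊗[R] H :=
  TensorProduct.map σ (LinearMap.mul' R H) ∘ₗ Coalgebra.comul (R := R) (A := H ⊗[R] H)

/-- The multiplication of `A #_σ H`, whose underlying module is `A ⊗ H`: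
`(a # h)(b # k) = ∑ a (h₁ b) σ(h₂ ⊗ k₁) # h₃ k₂`. -/
def crossedMul (ω : WeakAction R H A) (σ : H ⊗[R] H →ₗ[R] A) :
    (A ⊗[R] H) ⊗[R] (A ⊗[R] H) →ₗ[R] A ⊗[R] H :=
  leftMul R H A ∘ₗ
    (leftMul R H A ∘ₗ TensorProduct.map (TensorProduct.lift ω.act) (cocycleMul σ) ∘ₗ
      (TensorProduct.tensorTensorTensorComm R H H A H).toLinearMap ∘ₗ
      (Coalgebra.comul (R := R) (A := H)).rTensor (A ⊗[R] H)).lTensor A ∘ₗ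
    (TensorProduct.assoc R A H (A ⊗[R] H)).toLinearMap

/-- `A #_σ H` is a right `H`-crossed product: its multiplication is associative with
unity `1 # 1`. -/
structure IsCrossedProduct (ω : WeakAction R H A) (σ : H ⊗[R] H →ₗ[R] A) : Prop where
  mul_assoc : ∀ x y z : A ⊗[R] H,
    crossedMul ω σ (crossedMul ω σ (x ⊗ₜ y) ⊗ₜ z) = crossedMul ω σ (x ⊗ₜ crossedMul ω σ (y ⊗ₜ z))
  one_mul : ∀ x : A ⊗[R] H, crossedMul ω σ ((1 ⊗ₜ 1) ⊗ₜ x) = x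
  mul_one : ∀ x : A ⊗[R] H, crossedMul ω σ (x ⊗ₜ (1 ⊗ₜ 1)) = x

variable (R H A) in
/-- The right `H`-coaction `id ⊗ Δ` of `A #_σ H`. -/
def crossedCoaction : A ⊗[R] H →ₗ[R] (A ⊗[R] H) ⊗[R] H :=
  (TensorProduct.assoc R A H H).symm.toLinearMap ∘ₗ
    (Coalgebra.comul (R := R) (A := H)).lTensor A

end Crossed

/-! ### Left `H`-module subalgebras of `H*` and the opposite smash product -/

section Smash

variable (R : Type u) (H : Type v) [CommRing R] [Ring H] [HopfAlgebra R H]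

/-- The convolution product of `H*`. -/
def dualMul : Module.Dual R H →ₗ[R] Module.Dual R H →ₗ[R] Module.Dual R H :=
  LinearMap.mk₂ R (fun f g => (toConv f * toConv g).ofConv)
    (fun f g h => by rw [toConv_add, add_mul, ofConv_add])
    (fun c f g => by rw [toConv_smul, smul_mul_assoc, ofConv_smul])
    (fun f g h => by rw [toConv_add, mul_add, ofConv_add])
    (fun c f g => by rw [toConv_smul, mul_smul_comm, ofConv_smul])

/-- The left regular action `(h f)(k) = f(k h)`. -/
def dualAct : H →ₗ[R] Module.Dual R H →ₗ[R] Module.Dual R H :=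
  LinearMap.mk₂ R (fun h f => f ∘ₗ LinearMap.mulRight R h)
    (fun h k f => by ext; simp [mul_add])
    (fun c h f => by ext; simp)
    (fun h f g => by ext; simp)
    (fun c h f => by ext; simp)

/-- A left `H`-module subalgebra of `H*` (not required to contain the unity `ε` of `H*`). -/
structure LeftModuleSubalgebra extends Submodule R (Module.Dual R H) where
  dualMul_mem : ∀ {f g : Module.Dual R H}, f ∈ toSubmodule → g ∈ toSubmodule →
    dualMul R H f g ∈ toSubmodule
  dualAct_mem : ∀ (h : H) {f : Module.Dual R H}, f ∈ toSubmodule → dualAct R H h f ∈ toSubmodule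

variable {R H}

/-- `g ↦ (h g) ⋆ f` on `U`, for `h ∈ H` and `f ∈ U`. -/
def LeftModuleSubalgebra.actMulAux (U : LeftModuleSubalgebra R H) (h : H) (f : U.toSubmodule) :
    U.toSubmodule →ₗ[R] U.toSubmodule :=
  ((dualMul R H).flip f.1 ∘ₗ dualAct R H h ∘ₗ U.toSubmodule.subtype).codRestrict U.toSubmodule
    (fun g => U.dualMul_mem (U.dualAct_mem h g.2) f.2)

theorem LeftModuleSubalgebra.coe_actMulAux (U : LeftModuleSubalgebra R H) (h : H)
    (f g : U.toSubmodule) :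
    (U.actMulAux h f g : Module.Dual R H) = dualMul R H (dualAct R H h g) f := rfl

/-- `(h ⊗ f) ⊗ g ↦ (h g) ⋆ f` on `U`. -/
def LeftModuleSubalgebra.actMul (U : LeftModuleSubalgebra R H) :
    (H ⊗[R] U.toSubmodule) ⊗[R] U.toSubmodule →ₗ[R] U.toSubmodule :=
  TensorProduct.lift (TensorProduct.lift (LinearMap.mk₂ R U.actMulAux
    (fun h k f => LinearMap.ext fun g => Subtype.ext (by simp [coe_actMulAux]))
    (fun c h f => LinearMap.ext fun g => Subtype.ext (by simp [coe_actMulAux]))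
    (fun h f g => LinearMap.ext fun g => Subtype.ext (by simp [coe_actMulAux]))
    (fun c h f => LinearMap.ext fun g => Subtype.ext (by simp [coe_actMulAux]))))

/-- The multiplication of `B #^op U`, whose underlying module is `B ⊗ U`, for `B` with
multiplication `m` and right `H`-coaction `b ↦ ∑ b₀ ⊗ b₁`:
`(b # f)(c # g) = ∑ b₀ c # (b₁ g) ⋆ f`. -/
def smashOpMul {B : Type*} [AddCommGroup B] [Module R B] (m : B ⊗[R] B →ₗ[R] B)
    (coact : B →ₗ[R] B ⊗[R] H) (U : LeftModuleSubalgebra R H) :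
    (B ⊗[R] U.toSubmodule) ⊗[R] (B ⊗[R] U.toSubmodule) →ₗ[R] B ⊗[R] U.toSubmodule :=
  TensorProduct.map m U.actMul ∘ₗ
    (TensorProduct.tensorTensorTensorComm R B (H ⊗[R] U.toSubmodule) B
      U.toSubmodule).toLinearMap ∘ₗ
    ((TensorProduct.assoc R B H U.toSubmodule).toLinearMap ∘ₗ
      coact.rTensor U.toSubmodule).rTensor (B ⊗[R] U.toSubmodule)

/-- `f ⇀ k = ∑ k₁ f(k₂)`. -/
def leftHit (f : Module.Dual R H) : H →ₗ[R] H :=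
  (TensorProduct.rid R H).toLinearMap ∘ₗ f.lTensor H ∘ₗ Coalgebra.comul

/-- `k ↼ f = ∑ f(k₁) k₂`. -/
def rightHit (f : Module.Dual R H) : H →ₗ[R] H :=
  (TensorProduct.lid R H).toLinearMap ∘ₗ f.rTensor H ∘ₗ Coalgebra.comul

/-- The RL-condition for `(V, U)`: for every `g ∈ V` there are finitely many `(h_j, g_j)` in
`H × U` with `k ↼ g = ∑ (g_j ⇀ k) h_j` for all `k`. -/
def RLCondition (V U : Submodule R (Module.Dual R H)) : Prop :=
  ∀ g ∈ V, ∃ (n : ℕ) (h : Fin n → H) (f : Fin n → Module.Dual R H),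
    (∀ j, f j ∈ U) ∧ ∀ k : H, rightHit g k = ∑ j, leftHit (f j) k * h j

end Smash

/-! ### Compatibility -/

section Compatible

variable {R : Type u} {H : Type v} {A : Type w} [CommRing R] [Ring H] [HopfAlgebra R H]
  [Ring A] [Algebra R A]

/-- `φ(h ⊗ a)(k) = ∑ (k₁ a) σ(k₂ ⊗ h)`. -/
def phiMap (ω : WeakAction R H A) (σ : InvertibleCochain R H A) (h : H) (a : A) : H →ₗ[R] A :=
  LinearMap.mul' R A ∘ₗ
    TensorProduct.map (ω.act.flip a) ((TensorProduct.curry σ.map).flip h) ∘ₗ Coalgebra.comul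

/-- `k ↦ ∑ σ⁻¹(S(k₁) ⊗ k₂)`. -/
def psiAux₁ (σ : InvertibleCochain R H A) : H →ₗ[R] A :=
  σ.invMap ∘ₗ (HopfAlgebra.antipode R (A := H)).rTensor H ∘ₗ Coalgebra.comul

/-- `k ↦ ∑ σ⁻¹(S(k₂) ⊗ k₃) (S(k₁) a)`. -/
def psiAux₂ (ω : WeakAction R H A) (σ : InvertibleCochain R H A) (a : A) : H →ₗ[R] A :=
  LinearMap.mul' R A ∘ₗ
    TensorProduct.map (psiAux₁ σ) (ω.act.flip a ∘ₗ HopfAlgebra.antipode R (A := H)) ∘ₗ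
    (TensorProduct.comm R H H).toLinearMap ∘ₗ Coalgebra.comul

/-- `ψ(h ⊗ a)(k) = ∑ σ⁻¹(S(k₃) ⊗ k₄) (S(k₂) a) σ(S(k₁) ⊗ k₅ h)`. With
`∑ k₁ ⊗ k₂ ⊗ k₃ = (id ⊗ Δ)(Δ k)` this is computed as `∑ psiAux₂(k₂) σ(S(k₁) ⊗ k₃ h)`. -/
def psiMap (ω : WeakAction R H A) (σ : InvertibleCochain R H A) (h : H) (a : A) : H →ₗ[R] A :=
  LinearMap.mul' R A ∘ₗ
    TensorProduct.map (psiAux₂ ω σ a)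
      (σ.map ∘ₗ TensorProduct.map (HopfAlgebra.antipode R (A := H)) (LinearMap.mulRight R h)) ∘ₗ
    (TensorProduct.leftComm R H H H).toLinearMap ∘ₗ
    (Coalgebra.comul (R := R) (A := H)).lTensor H ∘ₗ Coalgebra.comul

/-- `(V, U)` is compatible: the images of `φ` and `ψ` lie in the image of
`A ⊗ V → Hom_R(H, A)`, and `(V, U)` satisfies the RL-condition. -/
structure IsCompatible (ω : WeakAction R H A) (σ : InvertibleCochain R H A)
    (V U : Submodule R (Module.Dual R H)) : Prop where
  phi_mem : ∀ (h : H) (a : A), phiMap ω σ h a ∈ LinearMap.range (alphaMap V A)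
  psi_mem : ∀ (h : H) (a : A), psiMap ω σ h a ∈ LinearMap.range (alphaMap V A)
  rl : RLCondition V U

/-- There are a dense `R`-subalgebra `L ⊆ End_R(H)^op` and an isomorphism of `R`-algebras
`(A #_σ H) #^op U ≃ A ⊗ L`. If `ε ∈ U`, so that the left-hand side has the unity `(1 # 1) # ε`,
then `L` contains the identity and the isomorphism preserves unities. -/
def HasDenseDuality (ω : WeakAction R H A) (σ : InvertibleCochain R H A)
    (U : LeftModuleSubalgebra R H) : Prop :=
  ∃ L : NonUnitalSubalgebra R (Module.End R H)ᵐᵒᵖ,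
    IsDenseIn {f : H →ₗ[R] H | MulOpposite.op (f : Module.End R H) ∈ L} Set.univ ∧
    ∃ e : (A ⊗[R] H) ⊗[R] U.toSubmodule ≃ₗ[R] A ⊗[R] L,
      (∀ x y, e (smashOpMul (crossedMul ω σ.map) (crossedCoaction R H A) U (x ⊗ₜ y)) =
        e x * e y) ∧
      ∀ hU : (Coalgebra.counit : Module.Dual R H) ∈ U.toSubmodule, ∃ hL : 1 ∈ L,
        e ((1 ⊗ₜ 1) ⊗ₜ ⟨Coalgebra.counit, hU⟩) = 1 ⊗ₜ ⟨1, hL⟩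

end Compatible

/-! ### The finite dual -/

section FiniteDual

variable {R : Type u} {H : Type v} [CommRing R] [Ring H] [HopfAlgebra R H]

/-- `(a f b)(c) = f(b c a)` for `f ∈ H*`. -/
def biTranslate (a b : H) : Module.Dual R H →ₗ[R] Module.Dual R H where
  toFun f := f ∘ₗ LinearMap.mulLeft R b ∘ₗ LinearMap.mulRight R a
  map_add' _ _ := rfl
  map_smul' _ _ := rfl

/-- The sub-bimodule `H f H` of `H*`. -/
def biSpan (f : Module.Dual R H) : Submodule R (Module.Dual R H) :=
  Submodule.span R (Set.range fun p : H × H => biTranslate p.1 p.2 f)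

variable (R H) in
/-- The finite dual `H° = {f ∈ H* | H f H is finitely generated over R}`. -/
def finiteDual [IsNoetherianRing R] : Submodule R (Module.Dual R H) where
  carrier := {f | (biSpan f).FG}
  zero_mem' := by
    have : biSpan (0 : Module.Dual R H) = ⊥ := by
      rw [biSpan, Submodule.span_eq_bot]
      rintro _ ⟨p, rfl⟩
      exact map_zero _
    change (biSpan (0 : Module.Dual R H)).FG
    rw [this]
    exact Submodule.fg_bot
  add_mem' {f g} hf hg := by
    have hle : biSpan (f + g) ≤ biSpan f ⊔ biSpan g := by
      rw [biSpan, Submodule.span_le]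
      rintro _ ⟨p, rfl⟩
      simp only [map_add]
      exact Submodule.add_mem_sup (Submodule.subset_span ⟨p, rfl⟩)
        (Submodule.subset_span ⟨p, rfl⟩)
    have hn : IsNoetherian R (biSpan f ⊔ biSpan g : Submodule R (Module.Dual R H)) :=
      isNoetherian_of_fg_of_noetherian _ (Submodule.FG.sup hf hg)
    exact (isNoetherian_submodule.1 hn) _ hle
  smul_mem' c f hf := by
    have hle : biSpan (c • f) ≤ biSpan f := by
      rw [biSpan, Submodule.span_le]
      rintro _ ⟨p, rfl⟩
      simp only [map_smul]
      exact Submodule.smul_mem _ _ (Submodule.subset_span ⟨p, rfl⟩)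
    exact (isNoetherian_submodule.1 (isNoetherian_of_fg_of_noetherian _ hf)) _ hle

variable (R H) in
/-- `H` is a Hopf `α`-algebra: `H° ⊆ R^H` is pure. -/
def IsAlphaAlgebra [IsNoetherianRing R] : Prop :=
  IsPure (toFunctions (finiteDual R H))

variable (R H) in
/-- `H` is residually finite: the canonical map `H → H°*` is injective. -/
def IsResiduallyFinite [IsNoetherianRing R] : Prop :=
  Function.Injective ((finiteDual R H).subtype.flip : H →ₗ[R] Module.Dual R (finiteDual R H))

/-- `U ⊆ H°` is an `R`-subbialgebra: a pure submodule which is a subalgebra containing the unity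
`ε`, with `Δ(U) ⊆ U ⊗ U`, where `Δ(f) = ∑ f₁ ⊗ f₂` is given by `∑ f₁(h) f₂(k) = f(hk)`. -/
structure IsSubbialgebra [IsNoetherianRing R] (U : Submodule R (Module.Dual R H)) : Prop where
  le_finiteDual : U ≤ finiteDual R H
  pure : IsPure (Submodule.inclusion le_finiteDual)
  counit_mem : (Coalgebra.counit : Module.Dual R H) ∈ U
  dualMul_mem : ∀ f ∈ U, ∀ g ∈ U, dualMul R H f g ∈ U
  comul_mem : ∀ f ∈ U, ∃ (n : ℕ) (f₁ f₂ : Fin n → Module.Dual R H),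
    (∀ i, f₁ i ∈ U) ∧ (∀ i, f₂ i ∈ U) ∧ ∀ h k : H, ∑ i, f₁ i h * f₂ i k = f (h * k)

end FiniteDual

end

end HopfDuality

/-! Put `B = A #_σ H`, `γ(h) = 1 # h`, and write `*` for convolution. Both algebras are realised in
`Hom_R(H, A ⊗ H)`, seen as the left `A`-linear endomorphisms of `A ⊗ H` under reversed composition.
An element `x # f` of `B #^op U` becomes `k ↦ γ(f ⇀ k) x` (`crossedMap`), whose `A`-linear extension
is `z ↦ (f ⇀ z) x`. Since the coaction of `B` is multiplicative, products go to reversed composites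
(`crossedMap_smashOpMul`). On the other side `L` consists of the sums of maps `k ↦ (f ⇀ k) h`, and
`A ⊗ L` acts by `a ⊗ l ↦ [k ↦ a ⊗ l(k)]` (`tensorEval`). Pulled back to `A ⊗ H ⊗ U` this is
`plainMap`.

Injectivity: `crossedMap` and `plainMap` are `α` followed by left convolution with `γ`, respectively
with `k ↦ 1 ⊗ k`. Both of these are convolution-invertible (`sectInv_mul_sect`, `sect_mul_sectInv`),
so injectivity of `α` passes to both maps.

Equal images (`range_crossedMap`): this is where compatibility enters. An element of `B` is
recovered from its coaction through `id ⊗ ε`. This expresses `γ(k)(a # h)` through `φ` as `∑ φ(h₁ ⊗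
a)(k₁) # k₂ h₂`, and the maps `φ(h₁ ⊗ a)` lie in the image of `A ⊗ V`. The RL-condition then turns
`k ↼ v` into a sum of `(f ⇀ k) l`. In the other direction, with `λ` the inverse of `γ`, the map `k ↦
∑ λ(k₁)(a # k₂ h)` equals `∑ ψ(h₁ ⊗ a)(k₂) # S(k₁) k₃ h₂`. The RL-condition and `∑ S(k₁) k₂ f(k₃) =
f(k)` place it in the image of `α`, and convolving with `γ` gives `a # k h`.

Density of `L`: a dual basis of `H` and density of `U` approximate every linear map by elements of
the image of `α`; convolving with `id`, whose inverse is `S`, carries this over to `L`. Part (2)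
rests on the injectivity of `M ⊗ R^X → M^X` over a Noetherian ring. In part (3) purity gives
injectivity in the same way, and density holds because a QF ring is a cogenerator, so that a
submodule of `H*` separating points is dense. -/

namespace HopfDuality

noncomputable section

/-! ### Convolution identities in a Hopf algebra -/

section Hopf

variable {R H : Type*} [CommRing R] [Ring H] [HopfAlgebra R H]

/-- In terms of the two inclusions of `H` into `H ⊗ H`, the comultiplication is their convolution
product. -/
theorem comul_eq_convMul :
    toConv (Coalgebra.comul (R := R) (A := H)) =
      toConv (Algebra.TensorProduct.includeLeft (R := R) (S := R) (A := H) (B := H)).toLinearMap *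
      toConv (Algebra.TensorProduct.includeRight (R := R) (A := H) (B := H)).toLinearMap := by
  ext k
  rw [(Coalgebra.Repr.arbitrary R k).convMul_apply]
  simp [(Coalgebra.Repr.arbitrary R k).eq]

theorem algHom_comp_one {D B C : Type*} [AddCommGroup D] [Module R D] [Coalgebra R D]
    [Ring B] [Algebra R B] [Ring C] [Algebra R C] (g : B →ₐ[R] C) :
    toConv (g.toLinearMap ∘ₗ (1 : WithConv (D →ₗ[R] B)).ofConv) = 1 := by
  ext k
  simp

theorem algHom_comp_convMul {D B C : Type*} [AddCommGroup D] [Module R D] [Coalgebra R D]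
    [Ring B] [Algebra R B] [Ring C] [Algebra R C]
    (g : B →ₐ[R] C) (f f' : D →ₗ[R] B) :
    toConv (g.toLinearMap ∘ₗ (toConv f * toConv f').ofConv) =
      toConv (g.toLinearMap ∘ₗ f) * toConv (g.toLinearMap ∘ₗ f') := by
  rw [LinearMap.algHom_comp_convMul_distrib]

/-- An algebra morphism carries the identity `S * id = ε` to its target. This is used mainly for the
two inclusions into a tensor product, so that coproduct identities become cancellations in a
convolution ring. -/
theorem algHom_antipode_convMul {B : Type*} [Ring B] [Algebra R B] (g : H →ₐ[R] B) :
    toConv (g.toLinearMap ∘ₗ HopfAlgebra.antipode R (A := H)) * toConv g.toLinearMap = 1 := by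
  have := algHom_comp_convMul g (HopfAlgebra.antipode R (A := H)) LinearMap.id
  rw [LinearMap.antipode_mul_id, algHom_comp_one] at this
  exact this.symm

theorem algHom_convMul_antipode {B : Type*} [Ring B] [Algebra R B] (g : H →ₐ[R] B) :
    toConv g.toLinearMap * toConv (g.toLinearMap ∘ₗ HopfAlgebra.antipode R (A := H)) = 1 := by
  have := algHom_comp_convMul g LinearMap.id (HopfAlgebra.antipode R (A := H))
  rw [LinearMap.id_mul_antipode, algHom_comp_one] at this
  exact this.symm

/-- The antipode is an anti-homomorphism of coalgebras. -/
theorem comul_antipode (k : H) :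
    Coalgebra.comul (R := R) (HopfAlgebra.antipode R k) =
      TensorProduct.map (HopfAlgebra.antipode R) (HopfAlgebra.antipode R)
        (TensorProduct.comm R H H (Coalgebra.comul k)) := by
  -- Left and right inverses agree: the right-hand side is a left convolution inverse of `Δ` (`h3`),
  -- while `Δ ∘ S` is a right inverse (`h2`).
  have h1 : toConv (TensorProduct.map (HopfAlgebra.antipode R) (HopfAlgebra.antipode R) ∘ₗ
      (TensorProduct.comm R H H).toLinearMap ∘ₗ Coalgebra.comul (R := R) (A := H)) =
      toConv ((Algebra.TensorProduct.includeRight (R := R) (A := H) (B := H)).toLinearMap ∘ₗ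
        HopfAlgebra.antipode R) *
      toConv ((Algebra.TensorProduct.includeLeft (R := R) (S := R) (A := H) (B := H)).toLinearMap ∘ₗ
        HopfAlgebra.antipode R) := by
    ext k
    rw [(Coalgebra.Repr.arbitrary R k).convMul_apply]
    simp [← (Coalgebra.Repr.arbitrary R k).eq]
  have h2 := LinearMap.comul_right_inv (R := R) (C := H)
  have h3 : toConv (TensorProduct.map (HopfAlgebra.antipode R) (HopfAlgebra.antipode R) ∘ₗ
      (TensorProduct.comm R H H).toLinearMap ∘ₗ Coalgebra.comul (R := R) (A := H)) *
      toConv (Coalgebra.comul (R := R) (A := H)) = 1 := by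
    rw [h1, comul_eq_convMul, mul_assoc, ← mul_assoc (toConv (_ ∘ₗ HopfAlgebra.antipode R))
      (toConv (AlgHom.toLinearMap _)), algHom_antipode_convMul, one_mul, algHom_antipode_convMul]
  exact congr($(left_inv_eq_right_inv h3 h2).ofConv k).symm

/-- `f ⇀ (-)` is the convolution product of the identity and `f`. -/
theorem leftHit_eq_convMul (f : Module.Dual R H) :
    toConv (leftHit f) = toConv LinearMap.id * toConv (Algebra.linearMap R H ∘ₗ f) := by
  ext k
  rw [(Coalgebra.Repr.arbitrary R k).convMul_apply]
  simp [leftHit, ← (Coalgebra.Repr.arbitrary R k).eq, Algebra.algebraMap_eq_smul_one]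

/-- Coassociativity: both sides are `∑ k₁ f(k₂) g(k₃)`. -/
theorem leftHit_dualMul (f g : Module.Dual R H) (k : H) :
    leftHit (dualMul R H f g) k = leftHit f (leftHit g k) := by
  have h : ∀ t : H ⊗[R] H,
      leftHit f (TensorProduct.rid R H (g.lTensor H t)) =
        TensorProduct.rid R H (LinearMap.lTensor H (TensorProduct.lid R R ∘ₗ TensorProduct.map f g)
          (TensorProduct.assoc R H H H (Coalgebra.comul.rTensor H t))) := by
    intro t
    induction t with
    | zero => simp
    | add x y hx hy => simp only [map_add, hx, hy]
    | tmul x y =>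
      simp only [leftHit, LinearMap.comp_apply, LinearMap.lTensor_tmul, LinearMap.rTensor_tmul,
        TensorProduct.rid_tmul, map_smul, LinearEquiv.coe_coe]
      induction Coalgebra.comul (R := R) x with
      | zero => simp
      | add x y hx hy => simp only [map_add, hx, hy, smul_add, TensorProduct.add_tmul]
      | tmul x z => simp [smul_smul, mul_comm]
  rw [show leftHit g k = TensorProduct.rid R H (g.lTensor H (Coalgebra.comul k)) from rfl, h,
    Coalgebra.coassoc_apply, ← LinearMap.comp_apply (LinearMap.lTensor H _),
    ← LinearMap.lTensor_comp]
  rfl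

end Hopf

/-! ### The crossed product as an algebra and as a comodule -/

section Crossed

variable {R H A : Type*} [CommRing R] [Ring H] [HopfAlgebra R H] [Ring A] [Algebra R A]

/-- The ring `A #_σ H`. -/
def CrossedProduct {ω : WeakAction R H A} {σ : H ⊗[R] H →ₗ[R] A} (_ : IsCrossedProduct ω σ) :
    Type _ := A ⊗[R] H

namespace CrossedProduct

section Ring

variable {ω : WeakAction R H A} {σ : H ⊗[R] H →ₗ[R] A} (hσ : IsCrossedProduct ω σ)

instance : AddCommGroup (CrossedProduct hσ) := inferInstanceAs (AddCommGroup (A ⊗[R] H))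

instance : Module R (CrossedProduct hσ) := inferInstanceAs (Module R (A ⊗[R] H))

/-- The identification of the module `A ⊗ H` with `A #_σ H`. -/
def mk : A ⊗[R] H ≃ₗ[R] CrossedProduct hσ := LinearEquiv.refl R _

instance : Ring (CrossedProduct hσ) where
  __ := (inferInstance : AddCommGroup (CrossedProduct hσ))
  mul x y := mk hσ (crossedMul ω σ ((mk hσ).symm x ⊗ₜ (mk hσ).symm y))
  one := mk hσ (1 ⊗ₜ 1)
  left_distrib x y z := by
    change mk hσ _ = mk hσ _ + mk hσ _
    rw [map_add, TensorProduct.tmul_add, map_add, map_add]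
  right_distrib x y z := by
    change mk hσ _ = mk hσ _ + mk hσ _
    rw [map_add, TensorProduct.add_tmul, map_add, map_add]
  zero_mul x := by
    change mk hσ _ = 0
    rw [map_zero, TensorProduct.zero_tmul, map_zero, map_zero]
  mul_zero x := by
    change mk hσ _ = 0
    rw [map_zero, TensorProduct.tmul_zero, map_zero, map_zero]
  mul_assoc x y z := congr(mk hσ $(hσ.mul_assoc _ _ _))
  one_mul x := congr(mk hσ $(hσ.one_mul _))
  mul_one x := congr(mk hσ $(hσ.mul_one _))

theorem mk_mul_mk (x y : A ⊗[R] H) : mk hσ x * mk hσ y = mk hσ (crossedMul ω σ (x ⊗ₜ y)) := rfl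

theorem one_def : (1 : CrossedProduct hσ) = mk hσ (1 ⊗ₜ 1) := rfl

instance : Algebra R (CrossedProduct hσ) :=
  Algebra.ofModule
    (fun r x y => by
      obtain ⟨x, rfl⟩ := (mk hσ).surjective x
      obtain ⟨y, rfl⟩ := (mk hσ).surjective y
      rw [← map_smul, mk_mul_mk, mk_mul_mk, ← TensorProduct.smul_tmul', map_smul, map_smul])
    (fun r x y => by
      obtain ⟨x, rfl⟩ := (mk hσ).surjective x
      obtain ⟨y, rfl⟩ := (mk hσ).surjective y
      rw [← map_smul, mk_mul_mk, mk_mul_mk, TensorProduct.tmul_smul, map_smul, map_smul])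

end Ring

end CrossedProduct

theorem leftMul_tmul (a : A) (x : A ⊗[R] H) :
    leftMul R H A (a ⊗ₜ x) = (LinearMap.mulLeft R a).rTensor H x := by
  induction x with
  | zero => simp
  | add x y hx hy => rw [TensorProduct.tmul_add, map_add, map_add, hx, hy]
  | tmul b h => simp [leftMul]

theorem leftMul_leftMul (a b : A) (x : A ⊗[R] H) :
    leftMul R H A (a ⊗ₜ leftMul R H A (b ⊗ₜ x)) = leftMul R H A ((a * b) ⊗ₜ x) := by
  simp only [leftMul_tmul, ← LinearMap.comp_apply, ← LinearMap.rTensor_comp]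
  congr 2
  ext
  simp

theorem leftMul_one (x : A ⊗[R] H) : leftMul R H A (1 ⊗ₜ x) = x := by
  rw [leftMul_tmul]
  simp

theorem crossedMul_tmul (ω : WeakAction R H A) (σ : H ⊗[R] H →ₗ[R] A) (a b : A) (h k : H) :
    crossedMul ω σ ((a ⊗ₜ h) ⊗ₜ (b ⊗ₜ k)) =
      ∑ i ∈ (Coalgebra.Repr.arbitrary R h).index,
        leftMul R H A ((a * ω.act ((Coalgebra.Repr.arbitrary R h).left i) b) ⊗ₜ
          cocycleMul σ ((Coalgebra.Repr.arbitrary R h).right i ⊗ₜ k)) := by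
  simp only [crossedMul, LinearMap.comp_apply, LinearEquiv.coe_coe, TensorProduct.assoc_tmul,
    LinearMap.lTensor_tmul, LinearMap.rTensor_tmul, ← (Coalgebra.Repr.arbitrary R h).eq,
    TensorProduct.sum_tmul, map_sum, TensorProduct.tmul_sum,
    TensorProduct.tensorTensorTensorComm_tmul, TensorProduct.map_tmul, TensorProduct.lift.tmul,
    leftMul_leftMul]

theorem WeakAction.act_one_apply (ω : WeakAction R H A) (h : H) :
    ω.act h 1 = algebraMap R A (Coalgebra.counit h) :=
  congr($(ω.act_one).ofConv h)

theorem crossedMul_tmul_one (ω : WeakAction R H A) (σ : H ⊗[R] H →ₗ[R] A) (a : A) (h k : H) :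
    crossedMul ω σ ((a ⊗ₜ h) ⊗ₜ (1 ⊗ₜ k)) = leftMul R H A (a ⊗ₜ cocycleMul σ (h ⊗ₜ k)) := by
  rw [crossedMul_tmul]
  conv_rhs => rw [← Coalgebra.sum_counit_smul (Coalgebra.Repr.arbitrary R h)]
  simp only [ω.act_one_apply, TensorProduct.sum_tmul, map_sum, TensorProduct.tmul_sum,
    ← TensorProduct.smul_tmul', map_smul, TensorProduct.tmul_smul,
    Algebra.algebraMap_eq_smul_one, mul_smul_comm, mul_one]

/-- `τ(d) = ∑ σ(d₁) ⊗ μ(d₂)` is a morphism of right comodules. -/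
theorem lTensor_comul_cocycleMul (σ : H ⊗[R] H →ₗ[R] A) (d : H ⊗[R] H) :
    crossedCoaction R H A (cocycleMul σ d) =
      TensorProduct.map (cocycleMul σ) (LinearMap.mul' R H) (Coalgebra.comul d) := by
  have h1 : ∀ t : (H ⊗[R] H) ⊗[R] (H ⊗[R] H),
      crossedCoaction R H A (TensorProduct.map σ (LinearMap.mul' R H) t) =
        (TensorProduct.map (TensorProduct.map σ (LinearMap.mul' R H)) (LinearMap.mul' R H))
        ((TensorProduct.assoc R _ _ _).symm (Coalgebra.comul.lTensor (H ⊗[R] H) t)) := by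
    intro t
    induction t with
    | zero => simp
    | add x y hx hy => simp only [map_add, hx, hy]
    | tmul x y =>
      have : Coalgebra.comul (R := R) (LinearMap.mul' R H y) =
          TensorProduct.map (LinearMap.mul' R H) (LinearMap.mul' R H) (Coalgebra.comul y) :=
        (CoalgHomClass.map_comp_comul_apply (Bialgebra.mulCoalgHom R H) y).symm
      simp only [crossedCoaction, LinearMap.comp_apply, TensorProduct.map_tmul,
        LinearMap.lTensor_tmul, this]
      induction Coalgebra.comul (R := R) y with
      | zero => simp
      | add x y hx hy => simp only [map_add, hx, hy, TensorProduct.tmul_add]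
      | tmul y z => simp
  rw [cocycleMul, LinearMap.comp_apply, h1, Coalgebra.coassoc_symm_apply]
  induction Coalgebra.comul (R := R) d with
  | zero => simp
  | add x y hx hy => simp only [map_add, hx, hy]
  | tmul y z => simp

/-- The projection `id ⊗ ε` of `A ⊗ H` onto `A`. -/
def counitProj (R H A : Type*) [CommRing R] [Ring H] [HopfAlgebra R H] [Ring A] [Algebra R A] :
    A ⊗[R] H →ₗ[R] A :=
  (TensorProduct.rid R A).toLinearMap ∘ₗ (Coalgebra.counit (R := R) (A := H)).lTensor A

@[simp]
theorem counitProj_tmul (a : A) (h : H) :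
    counitProj R H A (a ⊗ₜ h) = Coalgebra.counit (R := R) h • a := by
  simp [counitProj]

theorem counitProj_leftMul (a : A) (x : A ⊗[R] H) :
    counitProj R H A (leftMul R H A (a ⊗ₜ x)) = a * counitProj R H A x := by
  rw [leftMul_tmul]
  induction x with
  | zero => simp
  | add x y hx hy => simp only [map_add, mul_add, hx, hy]
  | tmul b h => simp

theorem counitProj_cocycleMul (σ : H ⊗[R] H →ₗ[R] A) (d : H ⊗[R] H) :
    counitProj R H A (cocycleMul σ d) = σ d := by
  have h1 : ∀ t : (H ⊗[R] H) ⊗[R] (H ⊗[R] H),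
      counitProj R H A (TensorProduct.map σ (LinearMap.mul' R H) t) =
        σ (TensorProduct.rid R _ (Coalgebra.counit.lTensor (H ⊗[R] H) t)) := by
    intro t
    induction t with
    | zero => simp
    | add x y hx hy => simp only [map_add, hx, hy]
    | tmul x y =>
      have : Coalgebra.counit (R := R) (LinearMap.mul' R H y) = Coalgebra.counit (R := R) y :=
        (CoalgHomClass.counit_comp_apply (Bialgebra.mulCoalgHom R H) y)
      simp [this]
  rw [cocycleMul, LinearMap.comp_apply, h1, Coalgebra.lTensor_counit_comul]
  simp

/-- The counit axiom. It lets an element of the crossed product be computed from the `A`-components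
of its coaction alone. -/
theorem rTensor_counitProj_crossedCoaction (x : A ⊗[R] H) :
    (counitProj R H A).rTensor H (crossedCoaction R H A x) = x := by
  induction x with
  | zero => simp
  | add x y hx hy => simp only [map_add, hx, hy]
  | tmul a h =>
    conv_rhs => rw [← Coalgebra.sum_counit_smul (Coalgebra.Repr.arbitrary R h)]
    simp [crossedCoaction, ← (Coalgebra.Repr.arbitrary R h).eq, TensorProduct.tmul_sum,
      TensorProduct.smul_tmul]

theorem crossedCoaction_tmul (a : A) (h : H) :
    crossedCoaction R H A (a ⊗ₜ h) =
      ∑ i ∈ (Coalgebra.Repr.arbitrary R h).index,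
        (a ⊗ₜ (Coalgebra.Repr.arbitrary R h).left i) ⊗ₜ (Coalgebra.Repr.arbitrary R h).right i := by
  simp [crossedCoaction, ← (Coalgebra.Repr.arbitrary R h).eq, TensorProduct.tmul_sum]

end Crossed

section Crossed

variable {R H A : Type*} [CommRing R] [Ring H] [HopfAlgebra R H] [Ring A] [Algebra R A]

/-- Left `A`-linearity is visible in the formula for the product and does not depend on
associativity of the crossed product. It makes `A` a subalgebra and reduces computations to products
of elements `1 # h`. -/
theorem crossedMul_leftMul (ω : WeakAction R H A) (σ : H ⊗[R] H →ₗ[R] A) (a : A) (x y : A ⊗[R] H) :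
    crossedMul ω σ (leftMul R H A (a ⊗ₜ x) ⊗ₜ y) = leftMul R H A (a ⊗ₜ crossedMul ω σ (x ⊗ₜ y)) := by
  induction x with
  | zero => simp
  | add x x' hx hx' => simp only [map_add, TensorProduct.tmul_add, TensorProduct.add_tmul, hx, hx']
  | tmul b h =>
    induction y with
    | zero => simp
    | add y y' hy hy' => simp only [map_add, TensorProduct.tmul_add, hy, hy']
    | tmul c k =>
      rw [leftMul_tmul, LinearMap.rTensor_tmul, crossedMul_tmul, crossedMul_tmul]
      simp only [TensorProduct.tmul_sum, map_sum, leftMul_leftMul, LinearMap.mulLeft_apply,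
        mul_assoc]

variable {ω : WeakAction R H A}

namespace CrossedProduct

/-! ### The section `h ↦ 1 # h` and multiplicativity of the coaction -/

section Cleft

variable {σ : H ⊗[R] H →ₗ[R] A} (hσ : IsCrossedProduct ω σ)

/-- The section `h ↦ 1 # h`. -/
def sect : H →ₗ[R] CrossedProduct hσ := (mk hσ).toLinearMap ∘ₗ TensorProduct.mk R A H 1

theorem sect_apply (h : H) : sect hσ h = mk hσ (1 ⊗ₜ h) := rfl

theorem mk_tmul_one_mul (a : A) (x : A ⊗[R] H) :
    mk hσ (a ⊗ₜ 1) * mk hσ x = mk hσ (leftMul R H A (a ⊗ₜ x)) := by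
  have : (a ⊗ₜ 1 : A ⊗[R] H) = leftMul R H A (a ⊗ₜ (1 ⊗ₜ 1)) := by simp [leftMul_tmul]
  rw [mk_mul_mk, this, crossedMul_leftMul, hσ.one_mul]

/-- The inclusion `a ↦ a # 1`. -/
def incl : A →ₐ[R] CrossedProduct hσ :=
  AlgHom.ofLinearMap ((mk hσ).toLinearMap ∘ₗ (TensorProduct.mk R A H).flip 1) rfl
    (fun a b => by
      simp only [LinearMap.comp_apply, LinearMap.flip_apply, TensorProduct.mk_apply,
        LinearEquiv.coe_coe]
      rw [mk_tmul_one_mul, leftMul_tmul]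
      simp)

theorem incl_apply (a : A) : incl hσ a = mk hσ (a ⊗ₜ 1) := rfl

theorem incl_mul_mk (a : A) (x : A ⊗[R] H) :
    incl hσ a * mk hσ x = mk hσ (leftMul R H A (a ⊗ₜ x)) :=
  mk_tmul_one_mul hσ a x

theorem mk_tmul (a : A) (h : H) : mk hσ (a ⊗ₜ h) = incl hσ a * sect hσ h := by
  rw [sect_apply, incl_mul_mk, leftMul_tmul]
  simp

@[elab_as_elim]
theorem induction_on {P : CrossedProduct hσ → Prop} (x : CrossedProduct hσ) (zero : P 0)
    (mul : ∀ a h, P (incl hσ a * sect hσ h)) (add : ∀ x y, P x → P y → P (x + y)) : P x := by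
  obtain ⟨x, rfl⟩ := (mk hσ).surjective x
  induction x with
  | zero => exact zero
  | tmul a h => rw [mk_tmul]; exact mul a h
  | add x y hx hy => rw [map_add]; exact add _ _ hx hy

theorem sect_mul_sect (h k : H) : sect hσ h * sect hσ k = mk hσ (cocycleMul σ (h ⊗ₜ k)) := by
  rw [sect_apply, sect_apply, mk_mul_mk, crossedMul_tmul_one, leftMul_one]

theorem sect_one : sect hσ 1 = 1 := rfl

theorem sect_mul_incl (h : H) (b : A) :
    sect hσ h * incl hσ b = ∑ i ∈ (Coalgebra.Repr.arbitrary R h).index,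
      incl hσ (ω.act ((Coalgebra.Repr.arbitrary R h).left i) b) *
        sect hσ ((Coalgebra.Repr.arbitrary R h).right i) := by
  rw [sect_apply, incl_apply, mk_mul_mk, crossedMul_tmul, map_sum]
  refine Finset.sum_congr rfl fun i _ => ?_
  rw [← incl_mul_mk, ← sect_mul_sect, one_mul, sect_one, mul_one]

/-- `h ↦ (1 # h) (b # 1)` is the convolution product of `h ↦ h b # 1` and `h ↦ 1 # h`. -/
theorem sect_mulRight_incl (b : A) :
    toConv (LinearMap.mulRight R (incl hσ b) ∘ₗ sect hσ) =
      toConv ((incl hσ).toLinearMap ∘ₗ ω.act.flip b) * toConv (sect hσ) := by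
  ext h
  rw [(Coalgebra.Repr.arbitrary R h).convMul_apply]
  exact sect_mul_incl hσ h b

theorem mk_cocycleMul :
    toConv ((mk hσ).toLinearMap ∘ₗ cocycleMul σ) =
      toConv ((incl hσ).toLinearMap ∘ₗ σ) * toConv (sect hσ ∘ₗ LinearMap.mul' R H) := by
  ext1
  rw [LinearMap.convMul_def, cocycleMul]
  simp only [← LinearMap.comp_assoc]
  congr 1
  refine TensorProduct.ext' fun x y => ?_
  simp [mk_tmul]

/-- The coaction of `A #_σ H`. -/
def coact : CrossedProduct hσ →ₗ[R] CrossedProduct hσ ⊗[R] H :=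
  (mk hσ).toLinearMap.rTensor H ∘ₗ crossedCoaction R H A ∘ₗ (mk hσ).symm.toLinearMap

theorem coact_mk (x : A ⊗[R] H) :
    coact hσ (mk hσ x) = (mk hσ).toLinearMap.rTensor H (crossedCoaction R H A x) := by
  simp [coact]

theorem coact_incl_mul_sect (a : A) (h : H) :
    coact hσ (incl hσ a * sect hσ h) = ∑ i ∈ (Coalgebra.Repr.arbitrary R h).index,
      (incl hσ a * sect hσ ((Coalgebra.Repr.arbitrary R h).left i)) ⊗ₜ
        (Coalgebra.Repr.arbitrary R h).right i := by
  rw [← mk_tmul, coact_mk, crossedCoaction_tmul, map_sum]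
  simp [mk_tmul]

theorem coact_sect (h : H) :
    coact hσ (sect hσ h) = ∑ i ∈ (Coalgebra.Repr.arbitrary R h).index,
      sect hσ ((Coalgebra.Repr.arbitrary R h).left i) ⊗ₜ
        (Coalgebra.Repr.arbitrary R h).right i := by
  have := coact_incl_mul_sect hσ 1 h
  simpa only [map_one, one_mul] using this

theorem coact_incl_mul (a : A) (x : CrossedProduct hσ) :
    coact hσ (incl hσ a * x) = (incl hσ a ⊗ₜ 1) * coact hσ x := by
  induction x using induction_on with
  | zero => simp
  | add x y hx hy => simp only [mul_add, map_add, hx, hy]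
  | mul b h =>
    rw [← mul_assoc, ← map_mul, coact_incl_mul_sect, coact_incl_mul_sect, Finset.mul_sum]
    simp [mul_assoc]

theorem coact_sect_eq_convMul :
    toConv (coact hσ ∘ₗ sect hσ) =
      toConv ((Algebra.TensorProduct.includeLeft (R := R) (S := R) (A := CrossedProduct hσ)
        (B := H)).toLinearMap ∘ₗ sect hσ) *
      toConv (Algebra.TensorProduct.includeRight (R := R) (A := CrossedProduct hσ)
        (B := H)).toLinearMap := by
  ext h
  rw [(Coalgebra.Repr.arbitrary R h).convMul_apply]
  simpa using coact_sect hσ h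

/-- The commutation rule `γ(·) b = (· b) * γ` is applied twice: once to pull the coefficient out of
the coaction on the left, and once, after inserting `∑ γ(h₁) ⊗ h₂`, to put `b` back on the right of
`γ`. -/
theorem coact_sect_mul_incl (h : H) (b : A) :
    coact hσ (sect hσ h * incl hσ b) = coact hσ (sect hσ h) * (incl hσ b ⊗ₜ 1) := by
  have h1 : toConv (coact hσ ∘ₗ LinearMap.mulRight R (incl hσ b) ∘ₗ sect hσ) =
      toConv (((Algebra.TensorProduct.includeLeft (R := R) (S := R) (A := CrossedProduct hσ)
        (B := H)).comp (incl hσ)).toLinearMap ∘ₗ ω.act.flip b) * toConv (coact hσ ∘ₗ sect hσ) := by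
    ext h
    rw [(Coalgebra.Repr.arbitrary R h).convMul_apply]
    simp only [LinearMap.comp_apply, LinearMap.mulRight_apply, sect_mul_incl, map_sum,
      coact_incl_mul]
    rfl
  rw [coact_sect_eq_convMul, ← mul_assoc, AlgHom.comp_toLinearMap, LinearMap.comp_assoc,
    ← algHom_comp_convMul, ← sect_mulRight_incl] at h1
  have h2 := congr($(h1).ofConv h)
  rw [(Coalgebra.Repr.arbitrary R h).convMul_apply] at h2
  refine h2.trans ?_
  rw [coact_sect, Finset.sum_mul]
  simp

theorem coact_sect_mul_sect (h k : H) :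
    coact hσ (sect hσ h * sect hσ k) = coact hσ (sect hσ h) * coact hσ (sect hσ k) := by
  rw [sect_mul_sect, coact_mk, lTensor_comul_cocycleMul, coact_sect, coact_sect,
    TensorProduct.comul_tmul, ← (Coalgebra.Repr.arbitrary R h).eq,
    ← (Coalgebra.Repr.arbitrary R k).eq, Finset.sum_mul_sum]
  simp only [TensorProduct.sum_tmul, TensorProduct.tmul_sum, map_sum]
  rw [Finset.sum_comm]
  simp [sect_mul_sect]

/-- By left `A`-linearity only `γ(h) b γ(k)` matters. Moving `b` to the left of `γ` reduces this to
the products `γ(h) γ(k)`, where `lTensor_comul_cocycleMul` applies. -/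
theorem coact_mul (x y : CrossedProduct hσ) : coact hσ (x * y) = coact hσ x * coact hσ y := by
  induction x using induction_on with
  | zero => simp
  | add x y hx hy => simp only [add_mul, map_add, hx, hy]
  | mul a h =>
    induction y using induction_on with
    | zero => simp
    | add x y hx hy => simp only [mul_add, map_add, hx, hy]
    | mul b k =>
      have key : coact hσ (sect hσ h * incl hσ b * sect hσ k) =
          coact hσ (sect hσ h * incl hσ b) * coact hσ (sect hσ k) := by
        rw [sect_mul_incl, Finset.sum_mul, map_sum, map_sum, Finset.sum_mul]
        refine Finset.sum_congr rfl fun i _ => ?_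
        rw [mul_assoc, coact_incl_mul, coact_sect_mul_sect, coact_incl_mul, mul_assoc]
      rw [mul_assoc, ← mul_assoc (sect hσ h), coact_incl_mul, key, coact_sect_mul_incl,
        coact_incl_mul, coact_incl_mul, mul_assoc, mul_assoc]

theorem coact_one : coact hσ 1 = 1 := by
  rw [one_def, coact_mk]
  simp [crossedCoaction, Algebra.TensorProduct.one_def, one_def]

/-- The coaction as a morphism of algebras. -/
def coactAlgHom : CrossedProduct hσ →ₐ[R] CrossedProduct hσ ⊗[R] H :=
  AlgHom.ofLinearMap (coact hσ) (coact_one hσ) (coact_mul hσ)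

/-- The projection `id ⊗ ε` onto `A`. -/
def proj : CrossedProduct hσ →ₗ[R] A := counitProj R H A ∘ₗ (mk hσ).symm.toLinearMap

theorem proj_mk (x : A ⊗[R] H) : proj hσ (mk hσ x) = counitProj R H A x := by simp [proj]

theorem proj_incl_mul (a : A) (x : CrossedProduct hσ) :
    proj hσ (incl hσ a * x) = a * proj hσ x := by
  obtain ⟨x, rfl⟩ := (mk hσ).surjective x
  rw [incl_mul_mk, proj_mk, proj_mk, counitProj_leftMul]

theorem proj_sect_mul_sect (h k : H) : proj hσ (sect hσ h * sect hσ k) = σ (h ⊗ₜ k) := by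
  rw [sect_mul_sect, proj_mk, counitProj_cocycleMul]

theorem proj_sect (h : H) : proj hσ (sect hσ h) = algebraMap R A (Coalgebra.counit h) := by
  simp [sect_apply, proj_mk, Algebra.algebraMap_eq_smul_one]

theorem mk_rTensor_proj_coact (x : CrossedProduct hσ) :
    mk hσ ((proj hσ).rTensor H (coact hσ x)) = x := by
  obtain ⟨x, rfl⟩ := (mk hσ).surjective x
  rw [coact_mk, ← LinearMap.comp_apply, ← LinearMap.rTensor_comp]
  congr 1
  conv_rhs => rw [← rTensor_counitProj_crossedCoaction x]
  rfl

end Cleft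

end CrossedProduct

end Crossed

/-! ### The maps `k ↦ ∑ F(k₂) ⊗ (S(k₁) ⊗ k₃)` -/

section Sandwich

variable {R H M : Type*} [CommRing R] [Ring H] [HopfAlgebra R H] [AddCommGroup M] [Module R M]

/-- `k ↦ ∑ F(k₂) ⊗ (S(k₁) ⊗ k₃)`. -/
def sandwich (F : H →ₗ[R] M) : H →ₗ[R] M ⊗[R] (H ⊗[R] H) :=
  TensorProduct.map F ((HopfAlgebra.antipode R).rTensor H) ∘ₗ
    (TensorProduct.leftComm R H H H).toLinearMap ∘ₗ
    (Coalgebra.comul (R := R) (A := H)).lTensor H ∘ₗ Coalgebra.comul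

theorem map_sandwich {N P : Type*} [AddCommGroup N] [Module R N] [AddCommGroup P] [Module R P]
    (F : H →ₗ[R] M) (g : M →ₗ[R] N) (g' : H ⊗[R] H →ₗ[R] P) (k : H) :
    TensorProduct.map g g' (sandwich F k) = g'.lTensor N (sandwich (g ∘ₗ F) k) := by
  simp only [sandwich, ← LinearMap.comp_apply, ← LinearMap.comp_assoc, ← TensorProduct.map_comp,
    LinearMap.lTensor, LinearMap.id_comp]

theorem sandwich_eq_convMul {M : Type*} [Ring M] [Algebra R M] (F : H →ₗ[R] M) :
    toConv (sandwich F) =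
      toConv (((Algebra.TensorProduct.includeRight (R := R) (A := M) (B := H ⊗[R] H)).comp
        (Algebra.TensorProduct.includeLeft (R := R) (S := R) (A := H) (B := H))).toLinearMap ∘ₗ
        HopfAlgebra.antipode R) *
      (toConv ((Algebra.TensorProduct.includeLeft (R := R) (S := R) (A := M)
        (B := H ⊗[R] H)).toLinearMap ∘ₗ F) *
      toConv ((Algebra.TensorProduct.includeRight (R := R) (A := M) (B := H ⊗[R] H)).comp
        (Algebra.TensorProduct.includeRight (R := R) (A := H) (B := H))).toLinearMap) := by
  ext1
  simp only [LinearMap.convMul_def, sandwich, ← LinearMap.comp_assoc]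
  congr 1
  refine TensorProduct.ext' fun x y => ?_
  simp only [LinearMap.comp_apply, LinearMap.lTensor_tmul, TensorProduct.map_tmul]
  induction Coalgebra.comul (R := R) y with
  | zero => simp
  | add y z hy hz => simp only [TensorProduct.tmul_add, map_add, hy, hz]
  | tmul y z => simp

/-- `k ↦ ∑ S(k₁) ⊗ k₂`. -/
def antipodeComul (R H : Type*) [CommRing R] [Ring H] [HopfAlgebra R H] : H →ₗ[R] H ⊗[R] H :=
  (HopfAlgebra.antipode R).rTensor H ∘ₗ Coalgebra.comul

theorem mul_antipodeComul (k : H) :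
    LinearMap.mul' R H (antipodeComul R H k) = algebraMap R H (Coalgebra.counit k) :=
  HopfAlgebra.mul_antipode_rTensor_comul_apply k

theorem antipodeComul_eq_convMul :
    toConv (antipodeComul R H) =
      toConv ((Algebra.TensorProduct.includeLeft (R := R) (S := R) (A := H) (B := H)).toLinearMap ∘ₗ
        HopfAlgebra.antipode R) *
      toConv (Algebra.TensorProduct.includeRight (R := R) (A := H) (B := H)).toLinearMap := by
  ext1
  simp only [LinearMap.convMul_def, antipodeComul, ← LinearMap.comp_assoc]
  congr 1
  refine TensorProduct.ext' fun x y => ?_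
  simp

/-- `Δ(S(k₁) ⊗ k₂)` is `∑ (S(k₂) ⊗ k₃) ⊗ (S(k₁) ⊗ k₄)`, because `S` reverses the coproduct. The two
inner factors combine to the same expression `S ⊗ id` of a coproduct, and no commutation is needed.
This makes convolution products over `H ⊗ H` computable along `k ↦ ∑ S(k₁) ⊗ k₂`. -/
theorem comul_antipodeComul (k : H) :
    Coalgebra.comul (R := R) (antipodeComul R H k) = sandwich (antipodeComul R H) k := by
  let iL := Algebra.TensorProduct.includeLeft (R := R) (S := R) (A := H) (B := H)
  let iR := Algebra.TensorProduct.includeRight (R := R) (A := H) (B := H)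
  let jL := Algebra.TensorProduct.includeLeft (R := R) (S := R) (A := H ⊗[R] H) (B := H ⊗[R] H)
  let jR := Algebra.TensorProduct.includeRight (R := R) (A := H ⊗[R] H) (B := H ⊗[R] H)
  let Δ := Bialgebra.comulAlgHom R (H ⊗[R] H)
  have hΔ (x y : H) : Δ (x ⊗ₜ y) = TensorProduct.AlgebraTensorModule.tensorTensorTensorComm
      R R R R H H H H (Coalgebra.comul x ⊗ₜ Coalgebra.comul y) := rfl
  have h1 : toConv (Δ.toLinearMap ∘ₗ iL.toLinearMap ∘ₗ HopfAlgebra.antipode R) =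
      toConv ((jR.comp iL).toLinearMap ∘ₗ HopfAlgebra.antipode R) *
        toConv ((jL.comp iL).toLinearMap ∘ₗ HopfAlgebra.antipode R) := by
    ext k
    simp only [iL, jL, jR, LinearMap.convMul_apply, LinearMap.comp_apply]
    simp only [AlgHom.toLinearMap_apply, Algebra.TensorProduct.includeLeft_apply,
      hΔ, comul_antipode]
    induction Coalgebra.comul (R := R) k with
    | zero => simp
    | add y z hy hz => simp only [TensorProduct.add_tmul, map_add, hy, hz]
    | tmul y z => simp [Algebra.TensorProduct.one_def]
  have h2 : toConv (Δ.toLinearMap ∘ₗ iR.toLinearMap) =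
      toConv (jL.comp iR).toLinearMap * toConv (jR.comp iR).toLinearMap := by
    ext k
    simp only [iR, jL, jR, LinearMap.convMul_apply, LinearMap.comp_apply]
    simp only [AlgHom.toLinearMap_apply, Algebra.TensorProduct.includeRight_apply,
      hΔ]
    induction Coalgebra.comul (R := R) k with
    | zero => simp
    | add y z hy hz => simp only [TensorProduct.tmul_add, map_add, hy, hz]
    | tmul y z => simp [Algebra.TensorProduct.one_def]
  have h3 : toConv (Δ.toLinearMap ∘ₗ antipodeComul R H) = toConv (sandwich (antipodeComul R H)) := by
    have h4 := algHom_comp_convMul Δ (iL.toLinearMap ∘ₗ HopfAlgebra.antipode R) iR.toLinearMap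
    rw [← antipodeComul_eq_convMul, h1, h2, mul_assoc, ← mul_assoc (toConv (_ ∘ₗ _))
      (toConv (jL.comp iR).toLinearMap)] at h4
    have h5 := algHom_comp_convMul jL (iL.toLinearMap ∘ₗ HopfAlgebra.antipode R) iR.toLinearMap
    rw [← antipodeComul_eq_convMul] at h5
    rw [sandwich_eq_convMul]
    refine h4.trans ?_
    congr 2
    exact h5.symm
  exact congr($(h3).ofConv k)

end Sandwich

/-! ### The convolution inverse of `h ↦ 1 # h`, and `φ`, `ψ` as `A`-components -/

section Crossed

variable {R H A : Type*} [CommRing R] [Ring H] [HopfAlgebra R H] [Ring A] [Algebra R A]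
  {ω : WeakAction R H A}

theorem psiMap_eq_sandwich (σ : InvertibleCochain R H A) (h : H) (a : A) (k : H) :
    psiMap ω σ h a k = LinearMap.mul' R A ((σ.map ∘ₗ (LinearMap.mulRight R h).lTensor H).lTensor A
      (sandwich (psiAux₂ ω σ a) k)) := by
  simp only [psiMap, sandwich, ← LinearMap.comp_apply, ← LinearMap.comp_assoc,
    ← TensorProduct.map_comp, LinearMap.lTensor, LinearMap.rTensor, LinearMap.id_comp]
  congr 5
  rw [LinearMap.comp_assoc, ← TensorProduct.map_comp]
  simp

namespace CrossedProduct

variable {σ : InvertibleCochain R H A} (hσ : IsCrossedProduct ω σ.map)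

/-- The convolution inverse `k ↦ ∑ σ⁻¹(S(k₂) ⊗ k₃) # S(k₁)` of `k ↦ 1 # k`. -/
def sectInv : H →ₗ[R] CrossedProduct hσ :=
  (mk hσ).toLinearMap ∘ₗ TensorProduct.map (psiAux₁ σ) (HopfAlgebra.antipode R) ∘ₗ
    (TensorProduct.comm R H H).toLinearMap ∘ₗ Coalgebra.comul

/-- In Sweedler form the coaction sends `λ(k)` to `∑ λ(k₂) ⊗ S(k₁)`, since `S` reverses the
coproduct. -/
theorem coact_sectInv :
    toConv (coact hσ ∘ₗ sectInv hσ) =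
      toConv ((Algebra.TensorProduct.includeRight (R := R) (A := CrossedProduct hσ)
        (B := H)).toLinearMap ∘ₗ HopfAlgebra.antipode R) *
      toConv ((Algebra.TensorProduct.includeLeft (R := R) (S := R) (A := CrossedProduct hσ)
        (B := H)).toLinearMap ∘ₗ sectInv hσ) := by
  -- `Θ` evaluates the expression on a threefold tensor. Expanding `Δ` on the first leg and
  -- rebracketing by coassociativity then gives the wanted form.
  let Θ : H ⊗[R] (H ⊗[R] H) →ₗ[R] CrossedProduct hσ ⊗[R] H :=
    (TensorProduct.comm R H (CrossedProduct hσ)).toLinearMap ∘ₗ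
      TensorProduct.map (HopfAlgebra.antipode R) ((mk hσ).toLinearMap ∘ₗ
        TensorProduct.map (psiAux₁ σ) (HopfAlgebra.antipode R) ∘ₗ
          (TensorProduct.comm R H H).toLinearMap)
  have h1 : ∀ t : H ⊗[R] H, coact hσ (mk hσ (TensorProduct.map (psiAux₁ σ) (HopfAlgebra.antipode R)
      (TensorProduct.comm R H H t))) =
        Θ (TensorProduct.assoc R H H H (Coalgebra.comul.rTensor H t)) := by
    intro t
    induction t with
    | zero => simp
    | add y z hy hz => simp only [map_add, hy, hz]
    | tmul x y =>
      simp only [TensorProduct.comm_tmul, TensorProduct.map_tmul, coact_mk, crossedCoaction,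
        LinearMap.comp_apply, LinearMap.lTensor_tmul, comul_antipode, LinearMap.rTensor_tmul]
      induction Coalgebra.comul (R := R) x with
      | zero => simp
      | add y z hy hz =>
        simp only [TensorProduct.tmul_add, TensorProduct.add_tmul, map_add, hy, hz]
      | tmul y z => simp [Θ]
  ext k
  refine (h1 (Coalgebra.comul k)).trans ?_
  rw [Coalgebra.coassoc_apply, LinearMap.convMul_apply, ← LinearMap.comp_apply Θ,
    ← LinearMap.comp_apply (LinearMap.mul' _ _)]
  congr 1
  refine TensorProduct.ext' fun x y => ?_
  simp [Θ, sectInv]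

theorem sect_mul_incl_eq_mk (h : H) (b : A) :
    sect hσ h * incl hσ b = mk hσ ((ω.act.flip b).rTensor H (Coalgebra.comul h)) := by
  rw [sect_mul_incl, ← (Coalgebra.Repr.arbitrary R h).eq]
  simp [mk_tmul]

theorem sectInv_mul_incl (k : H) (a : A) :
    sectInv hσ k * incl hσ a =
      mk hσ (TensorProduct.map (psiAux₂ ω σ a) (HopfAlgebra.antipode R)
        (TensorProduct.comm R H H (Coalgebra.comul k))) := by
  let Θ : H ⊗[R] (H ⊗[R] H) →ₗ[R] CrossedProduct hσ :=
    (mk hσ).toLinearMap ∘ₗ (TensorProduct.comm R H A).toLinearMap ∘ₗ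
      TensorProduct.map (HopfAlgebra.antipode R) (LinearMap.mul' R A ∘ₗ
        TensorProduct.map (psiAux₁ σ) (ω.act.flip a ∘ₗ HopfAlgebra.antipode R (A := H)) ∘ₗ
          (TensorProduct.comm R H H).toLinearMap)
  have h1 : ∀ t : H ⊗[R] H, mk hσ (TensorProduct.map (psiAux₁ σ) (HopfAlgebra.antipode R)
      (TensorProduct.comm R H H t)) * incl hσ a =
        Θ (TensorProduct.assoc R H H H (Coalgebra.comul.rTensor H t)) := by
    intro t
    induction t with
    | zero => simp
    | add y z hy hz => simp only [map_add, add_mul, hy, hz]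
    | tmul x y =>
      simp only [TensorProduct.comm_tmul, TensorProduct.map_tmul, mk_tmul, mul_assoc,
        sect_mul_incl_eq_mk, comul_antipode, LinearMap.rTensor_tmul]
      induction Coalgebra.comul (R := R) x with
      | zero => simp
      | add y z hy hz =>
        simp only [mul_add, TensorProduct.add_tmul, map_add, hy, hz]
      | tmul y z => simp [Θ, mk_tmul, mul_assoc]
  refine (h1 (Coalgebra.comul k)).trans ?_
  rw [Coalgebra.coassoc_apply, ← LinearMap.comp_apply Θ]
  change _ = ((mk hσ).toLinearMap ∘ₗ TensorProduct.map (psiAux₂ ω σ a) (HopfAlgebra.antipode R) ∘ₗ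
    (TensorProduct.comm R H H).toLinearMap) (Coalgebra.comul k)
  congr 1
  refine TensorProduct.ext' fun x y => ?_
  simp [Θ, psiAux₂]

/-- If `λ(k) z = ∑ F(k₂) # S(k₁)`, then
`∑ λ(k₁) z γ(k₂ h) = ∑ F(k₂) γ(S(k₁)) γ(k₃ h)`, where `γ(k) = 1 # k` and `λ` is its inverse. -/
theorem sectInv_convMul_sect {z : CrossedProduct hσ} {F : H →ₗ[R] A}
    (hF : ∀ k, sectInv hσ k * z = mk hσ (TensorProduct.map F (HopfAlgebra.antipode R)
        (TensorProduct.comm R H H (Coalgebra.comul k)))) (h k : H) :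
    (toConv (sectInv hσ) *
      toConv (LinearMap.mulLeft R z ∘ₗ sect hσ ∘ₗ LinearMap.mulRight R h)).ofConv k =
      LinearMap.mul' R (CrossedProduct hσ) (TensorProduct.map (incl hσ).toLinearMap
        ((mk hσ).toLinearMap ∘ₗ cocycleMul σ.map ∘ₗ (LinearMap.mulRight R h).lTensor H)
          (sandwich F k)) := by
  let Θ : H ⊗[R] (H ⊗[R] H) →ₗ[R] CrossedProduct hσ :=
    LinearMap.mul' R (CrossedProduct hσ) ∘ₗ TensorProduct.map (incl hσ).toLinearMap
        ((mk hσ).toLinearMap ∘ₗ cocycleMul σ.map ∘ₗ (LinearMap.mulRight R h).lTensor H) ∘ₗ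
    TensorProduct.map F ((HopfAlgebra.antipode R).rTensor H) ∘ₗ
    (TensorProduct.leftComm R H H H).toLinearMap
  have h1 : ∀ t : H ⊗[R] H, LinearMap.mul' R (CrossedProduct hσ)
      (TensorProduct.map (sectInv hσ)
        (LinearMap.mulLeft R z ∘ₗ sect hσ ∘ₗ LinearMap.mulRight R h) t) =
        Θ (TensorProduct.assoc R H H H (Coalgebra.comul.rTensor H t)) := by
    intro t
    induction t with
    | zero => simp
    | add y z hy hz => simp only [map_add, hy, hz]
    | tmul x y =>
      simp only [TensorProduct.map_tmul, LinearMap.mul'_apply, LinearMap.comp_apply,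
        LinearMap.mulLeft_apply, ← mul_assoc, hF, LinearMap.rTensor_tmul]
      induction Coalgebra.comul (R := R) x with
      | zero => simp
      | add y z hy hz =>
        simp only [add_mul, TensorProduct.add_tmul, map_add, hy, hz]
      | tmul y z => simp [Θ, mk_tmul, mul_assoc, sect_mul_sect]
  refine (h1 (Coalgebra.comul k)).trans ?_
  rw [Coalgebra.coassoc_apply]
  rfl

/-- With `θ(k) = ∑ S(k₁) ⊗ k₂`, the product evaluates to `(σ⁻¹ * (σ * γ ∘ μ))(θ(k))` by
`comul_antipodeComul`. Here `σ⁻¹ * σ` cancels and leaves `γ(μ(θ(k))) = ε(k) 1`. -/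
theorem sectInv_mul_sect : toConv (sectInv hσ) * toConv (sect hσ) = 1 := by
  ext k
  have h1 := sectInv_convMul_sect hσ (z := 1) (F := psiAux₁ σ)
    (fun k => by rw [mul_one]; rfl) 1 k
  rw [LinearMap.mulLeft_one, LinearMap.mulRight_one, LinearMap.id_comp, LinearMap.comp_id,
    LinearMap.lTensor_id, LinearMap.comp_id] at h1
  rw [h1]
  have h2 : psiAux₁ σ = σ.invMap ∘ₗ antipodeComul R H := rfl
  have h3 : sandwich (psiAux₁ σ) k =
      TensorProduct.map σ.invMap LinearMap.id (sandwich (antipodeComul R H) k) := by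
    rw [map_sandwich, h2]
    simp
  have h4 : toConv ((incl hσ).toLinearMap ∘ₗ σ.invMap) *
      toConv ((mk hσ).toLinearMap ∘ₗ cocycleMul σ.map) =
        toConv (sect hσ ∘ₗ LinearMap.mul' R H) := by
    rw [mk_cocycleMul, ← mul_assoc, ← algHom_comp_convMul]
    have : toConv σ.invMap * toConv σ.map = 1 := σ.inv_mul
    rw [this]
    rw [algHom_comp_one, one_mul]
  rw [h3, ← comul_antipodeComul, ← LinearMap.comp_apply (TensorProduct.map _ _),
    ← TensorProduct.map_comp, LinearMap.comp_id]
  refine congr($(h4).ofConv (antipodeComul R H k)).trans ?_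
  simp only [LinearMap.comp_apply, mul_antipodeComul]
  simp [Algebra.algebraMap_eq_smul_one, sect_one]

/-- The product `e = γ * λ` has coinvariant values, since `S` cancels in the middle of its coaction;
hence it takes values in `A`. The left inverse gives `e * γ = γ`, and applying `id ⊗ ε` forces `e =
ε`. -/
theorem sect_mul_sectInv : toConv (sect hσ) * toConv (sectInv hσ) = 1 := by
  set e := (toConv (sect hσ) * toConv (sectInv hσ)).ofConv with he
  have h1 : coact hσ ∘ₗ e = (Algebra.TensorProduct.includeLeft (R := R) (S := R)
      (A := CrossedProduct hσ) (B := H)).toLinearMap ∘ₗ e := by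
    apply toConv_injective
    have := algHom_comp_convMul (coactAlgHom hσ) (sect hσ) (sectInv hσ)
    rw [show (coactAlgHom hσ).toLinearMap = coact hσ from rfl] at this
    rw [he, this, coact_sect_eq_convMul, coact_sectInv, mul_assoc, ← mul_assoc (toConv (AlgHom.toLinearMap _))
      (toConv (AlgHom.toLinearMap _ ∘ₗ HopfAlgebra.antipode R)), algHom_convMul_antipode, one_mul,
      algHom_comp_convMul]
  have h2 : ∀ k, e k = incl hσ (proj hσ (e k)) := fun k => by
    conv_lhs => rw [← mk_rTensor_proj_coact hσ (e k), ← LinearMap.comp_apply (coact hσ), h1]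
    rfl
  have h3 : toConv e * toConv (sect hσ) = toConv (sect hσ) := by
    rw [he, toConv_ofConv, mul_assoc, sectInv_mul_sect, mul_one]
  have h4 : toConv (proj hσ ∘ₗ e) * 1 = toConv (Algebra.linearMap R A ∘ₗ Coalgebra.counit) := by
    ext k
    have h5 := congr(proj hσ ($(h3).ofConv k))
    rw [(Coalgebra.Repr.arbitrary R k).convMul_apply, map_sum] at h5
    rw [(Coalgebra.Repr.arbitrary R k).convMul_apply]
    refine Eq.trans (Finset.sum_congr rfl fun i _ => ?_) (h5.trans (proj_sect hσ k))
    rw [h2, proj_incl_mul, proj_sect]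
    rfl
  rw [mul_one] at h4
  ext k
  refine (h2 k).trans ?_
  rw [show proj hσ (e k) = _ from congr($(h4).ofConv k)]
  simp

/-- `k ↦ ∑ λ(k₁) (a # k₂ h)`, where `λ` is the convolution inverse of `k ↦ 1 # k`. -/
def psiLift (h : H) (a : A) : H →ₗ[R] CrossedProduct hσ :=
  (toConv (sectInv hσ) *
    toConv (LinearMap.mulLeft R (incl hσ a) ∘ₗ sect hσ ∘ₗ LinearMap.mulRight R h)).ofConv

theorem proj_psiLift (h : H) (a : A) (k : H) : proj hσ (psiLift hσ h a k) = psiMap ω σ h a k := by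
  rw [psiLift, sectInv_convMul_sect hσ (fun k => sectInv_mul_incl hσ k a), psiMap_eq_sandwich]
  induction sandwich (psiAux₂ ω σ a) k with
  | zero => simp
  | add y z hy hz => simp only [map_add, hy, hz]
  | tmul b t =>
    simp only [TensorProduct.map_tmul, LinearMap.mul'_apply, LinearMap.lTensor_tmul]
    refine (proj_incl_mul hσ b _).trans ?_
    simp [proj_mk, counitProj_cocycleMul]

/-- `k ↦ (1 # k) (a # h)`. -/
def phiLift (h : H) (a : A) : H →ₗ[R] CrossedProduct hσ :=
  LinearMap.mulRight R (incl hσ a * sect hσ h) ∘ₗ sect hσ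

theorem proj_phiLift (h : H) (a : A) (k : H) : proj hσ (phiLift hσ h a k) = phiMap ω σ h a k := by
  simp only [phiLift, phiMap, LinearMap.comp_apply, LinearMap.mulRight_apply, ← mul_assoc]
  rw [sect_mul_incl, ← (Coalgebra.Repr.arbitrary R k).eq, Finset.sum_mul]
  simp [mul_assoc, proj_incl_mul, proj_sect_mul_sect]

end CrossedProduct

end Crossed

/-! ### Recovering values in the crossed product from `φ` and `ψ` -/

section Lifts

variable {R H A : Type*} [CommRing R] [Ring H] [HopfAlgebra R H] [Ring A] [Algebra R A]
  {ω : WeakAction R H A}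

/-- `k ↦ ∑ F(k₂) ⊗ S(k₁) k₃ h`. -/
def sandwichMul {M : Type*} [AddCommGroup M] [Module R M] (F : H →ₗ[R] M) (h : H) :
    H →ₗ[R] M ⊗[R] H :=
  (LinearMap.mul' R H ∘ₗ (LinearMap.mulRight R h).lTensor H).lTensor M ∘ₗ sandwich F

theorem rTensor_sandwichMul {M N : Type*} [AddCommGroup M] [Module R M] [AddCommGroup N]
    [Module R N] (g : M →ₗ[R] N) (F : H →ₗ[R] M) (h k : H) :
    g.rTensor H (sandwichMul F h k) = sandwichMul (g ∘ₗ F) h k := by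
  have := map_sandwich F g (LinearMap.mul' R H ∘ₗ (LinearMap.mulRight R h).lTensor H) k
  refine Eq.trans ?_ this
  rw [sandwichMul, LinearMap.comp_apply, ← LinearMap.comp_apply, LinearMap.rTensor_comp_lTensor]

theorem sandwichMul_eq_convMul {M : Type*} [Ring M] [Algebra R M] (F : H →ₗ[R] M) (h : H) :
    toConv (sandwichMul F h) =
      toConv ((Algebra.TensorProduct.includeRight (R := R) (A := M) (B := H)).toLinearMap ∘ₗ
        HopfAlgebra.antipode R) *
      (toConv ((Algebra.TensorProduct.includeLeft (R := R) (S := R) (A := M)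
        (B := H)).toLinearMap ∘ₗ F) *
      toConv ((Algebra.TensorProduct.includeRight (R := R) (A := M) (B := H)).toLinearMap ∘ₗ
        LinearMap.mulRight R h)) := by
  ext1
  simp only [LinearMap.convMul_def, sandwich, sandwichMul, ← LinearMap.comp_assoc]
  congr 1
  refine TensorProduct.ext' fun x y => ?_
  simp only [LinearMap.comp_apply, LinearMap.lTensor_tmul, TensorProduct.map_tmul]
  induction Coalgebra.comul (R := R) y with
  | zero => simp
  | add y z hy hz => simp only [TensorProduct.tmul_add, map_add, hy, hz]
  | tmul y z => simp

namespace CrossedProduct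

section

variable {σ : H ⊗[R] H →ₗ[R] A} (hσ : IsCrossedProduct ω σ)

theorem coact_mulLeft_sect_mulRight (a : A) (h : H) :
    toConv (coact hσ ∘ₗ LinearMap.mulLeft R (incl hσ a) ∘ₗ sect hσ ∘ₗ LinearMap.mulRight R h) =
      ∑ i ∈ (Coalgebra.Repr.arbitrary R h).index,
        toConv ((Algebra.TensorProduct.includeLeft (R := R) (S := R) (A := CrossedProduct hσ)
          (B := H)).toLinearMap ∘ₗ LinearMap.mulLeft R (incl hσ a) ∘ₗ sect hσ ∘ₗ
            LinearMap.mulRight R ((Coalgebra.Repr.arbitrary R h).left i)) *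
        toConv ((Algebra.TensorProduct.includeRight (R := R) (A := CrossedProduct hσ)
          (B := H)).toLinearMap ∘ₗ
            LinearMap.mulRight R ((Coalgebra.Repr.arbitrary R h).right i)) := by
  ext k
  have h1 (h : H) : coact hσ (incl hσ a * sect hσ h) =
      TensorProduct.map (LinearMap.mulLeft R (incl hσ a) ∘ₗ sect hσ) LinearMap.id
        (Coalgebra.comul h) := by
    rw [coact_incl_mul_sect]
    conv_rhs => rw [← (Coalgebra.Repr.arbitrary R h).eq]
    simp
  simp only [LinearMap.comp_apply, LinearMap.mulLeft_apply, LinearMap.mulRight_apply, h1,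
    Bialgebra.comul_mul, ofConv_sum, LinearMap.sum_apply, LinearMap.convMul_apply]
  conv_lhs => rw [← (Coalgebra.Repr.arbitrary R h).eq, Finset.mul_sum, map_sum]
  refine Finset.sum_congr rfl fun i _ => ?_
  induction Coalgebra.comul (R := R) k with
  | zero => simp
  | add y z hy hz => simp only [add_mul, map_add, hy, hz]
  | tmul y z => simp

/-- The coaction of `γ(k)(a # h)` is `∑ γ(k₁)(a # h₁) ⊗ k₂ h₂`, and the `A`-component of its first
leg is `φ(h₁ ⊗ a)(k₁)`. -/
theorem phiLift_eq {σ : InvertibleCochain R H A} (hσ : IsCrossedProduct ω σ.map) (h : H) (a : A)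
    (k : H) :
    phiLift hσ h a k = mk hσ (∑ i ∈ (Coalgebra.Repr.arbitrary R h).index,
      TensorProduct.map (phiMap ω σ ((Coalgebra.Repr.arbitrary R h).left i) a)
        (LinearMap.mulRight R ((Coalgebra.Repr.arbitrary R h).right i)) (Coalgebra.comul k)) := by
  conv_lhs => rw [← mk_rTensor_proj_coact hσ (phiLift hσ h a k)]
  congr 1
  rw [phiLift, LinearMap.comp_apply, LinearMap.mulRight_apply, coact_mul, coact_sect,
    coact_incl_mul_sect, Finset.mul_sum, map_sum]
  refine Finset.sum_congr rfl fun i _ => ?_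
  rw [← (Coalgebra.Repr.arbitrary R k).eq, Finset.sum_mul, map_sum, map_sum]
  refine Finset.sum_congr rfl fun j _ => ?_
  rw [TensorProduct.map_tmul, ← proj_phiLift hσ]
  simp [phiLift, mul_assoc]

/-- The coaction contributes `S(k₁)` from `λ` and `k₃ h₂` from the translated section, around the
same expression with `h₁` in place of `h`. Its `A`-component is `ψ(h₁ ⊗ a)`. -/
theorem psiLift_eq {σ : InvertibleCochain R H A} (hσ : IsCrossedProduct ω σ.map) (h : H) (a : A)
    (k : H) :
    psiLift hσ h a k = mk hσ (∑ i ∈ (Coalgebra.Repr.arbitrary R h).index,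
      sandwichMul (psiMap ω σ ((Coalgebra.Repr.arbitrary R h).left i) a)
        ((Coalgebra.Repr.arbitrary R h).right i) k) := by
  have h1 : toConv (coact hσ ∘ₗ psiLift hσ h a) =
      ∑ i ∈ (Coalgebra.Repr.arbitrary R h).index,
        toConv (sandwichMul (psiLift hσ ((Coalgebra.Repr.arbitrary R h).left i) a)
          ((Coalgebra.Repr.arbitrary R h).right i)) := by
    have := algHom_comp_convMul (coactAlgHom hσ) (sectInv hσ)
      (LinearMap.mulLeft R (incl hσ a) ∘ₗ sect hσ ∘ₗ LinearMap.mulRight R h)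
    rw [show (coactAlgHom hσ).toLinearMap = coact hσ from rfl, coact_sectInv,
      coact_mulLeft_sect_mulRight, Finset.mul_sum] at this
    refine this.trans (Finset.sum_congr rfl fun i _ => ?_)
    rw [sandwichMul_eq_convMul, mul_assoc, ← mul_assoc (toConv (_ ∘ₗ sectInv hσ)),
      ← algHom_comp_convMul]
    rfl
  conv_lhs => rw [← mk_rTensor_proj_coact hσ (psiLift hσ h a k)]
  congr 1
  have h2 := congr((proj hσ).rTensor H ($(h1).ofConv k))
  refine h2.trans ?_
  rw [ofConv_sum, LinearMap.sum_apply, map_sum]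
  refine Finset.sum_congr rfl fun i _ => ?_
  refine (rTensor_sandwichMul _ _ _ _).trans ?_
  congr 2
  ext k
  exact proj_psiLift hσ _ a k

theorem sect_convMul_psiLift {σ : InvertibleCochain R H A} (hσ : IsCrossedProduct ω σ.map)
    (h : H) (a : A) (k : H) :
    (toConv (sect hσ) * toConv (psiLift hσ h a)).ofConv k = mk hσ (a ⊗ₜ (k * h)) := by
  rw [psiLift, toConv_ofConv, ← mul_assoc, sect_mul_sectInv, one_mul, mk_tmul]
  rfl

end

end CrossedProduct

end Lifts

/-! ### The actions `⇀` and left convolution -/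

section Hit

variable {R H : Type*} [CommRing R] [Ring H] [HopfAlgebra R H]

/-- Multiplying the second leg on the right by `t` and then evaluating `f` is evaluating `t f`. This
is how the `H`-action in the smash product arises. -/
theorem rid_lTensor_mul_tmul {M : Type*} [Ring M] [Algebra R M] (f : Module.Dual R H)
    (u : M ⊗[R] H) (x : M) (t : H) :
    TensorProduct.rid R M (f.lTensor M (u * x ⊗ₜ t)) =
      TensorProduct.rid R M ((dualAct R H t f).lTensor M u) * x := by
  induction u with
  | zero => simp
  | add y z hy hz => simp only [add_mul, map_add, hy, hz]
  | tmul y z => simp [dualAct]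

theorem leftHit_mul (f : Module.Dual R H) (k h : H) :
    leftHit f (k * h) = ∑ i ∈ (Coalgebra.Repr.arbitrary R h).index,
      leftHit (dualAct R H ((Coalgebra.Repr.arbitrary R h).right i) f) k *
        (Coalgebra.Repr.arbitrary R h).left i := by
  simp only [leftHit, LinearMap.comp_apply, Bialgebra.comul_mul, LinearEquiv.coe_coe]
  conv_lhs => rw [← (Coalgebra.Repr.arbitrary R h).eq, Finset.mul_sum, map_sum, map_sum]
  simp only [rid_lTensor_mul_tmul]

theorem leftHit_add (f g : Module.Dual R H) : leftHit (f + g) = leftHit f + leftHit g := by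
  ext k
  simp [leftHit, LinearMap.lTensor_add]

theorem leftHit_smul (r : R) (f : Module.Dual R H) : leftHit (r • f) = r • leftHit f := by
  ext k
  simp [leftHit, LinearMap.lTensor_smul]

theorem leftHit_counit (k : H) : leftHit (Coalgebra.counit (R := R)) k = k := by
  simp [leftHit]

theorem dualAct_one (f : Module.Dual R H) : dualAct R H 1 f = f := by
  ext
  simp [dualAct]

/-- Convolution by `g` on the left. -/
def convLeft {B : Type*} [Ring B] [Algebra R B] (g : H →ₗ[R] B) : (H →ₗ[R] B) →ₗ[R] (H →ₗ[R] B) :=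
  (WithConv.linearEquiv R (H →ₗ[R] B)).toLinearMap ∘ₗ LinearMap.mulLeft R (toConv g) ∘ₗ
    (WithConv.linearEquiv R (H →ₗ[R] B)).symm.toLinearMap

theorem convLeft_apply {B : Type*} [Ring B] [Algebra R B] (g F : H →ₗ[R] B) :
    convLeft g F = (toConv g * toConv F).ofConv := rfl

theorem convLeft_injective {B : Type*} [Ring B] [Algebra R B] {g g' : H →ₗ[R] B}
    (h : toConv g' * toConv g = 1) : Function.Injective (convLeft g) := by
  intro F G hFG
  have : toConv g * toConv F = toConv g * toConv G := congr(toConv $hFG)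
  have := congr((toConv g' * $this).ofConv)
  simpa only [← mul_assoc, h, one_mul] using this

theorem alphaMap_tmul (U : Submodule R (Module.Dual R H)) {M : Type*} [AddCommGroup M] [Module R M]
    (m : M) (f : U) (k : H) : alphaMap U M (m ⊗ₜ f) k = f.1 k • m := by
  simp [alphaMap]

/-- `∑ g(k₁) f(k₂) x = g(f ⇀ k) x`. -/
theorem convLeft_apply_smul {B : Type*} [Ring B] [Algebra R B] (g F : H →ₗ[R] B) (x : B)
    (f : Module.Dual R H) (hF : ∀ k, F k = f k • x) (k : H) :
    convLeft g F k = g (leftHit f k) * x := by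
  rw [convLeft_apply, (Coalgebra.Repr.arbitrary R k).convMul_apply, leftHit, LinearMap.comp_apply,
    LinearMap.comp_apply, ← (Coalgebra.Repr.arbitrary R k).eq]
  simp [hF, Finset.sum_mul]

end Hit

/-! ### The two representations in `Hom_R(H, A ⊗ H)` and their common image -/

section Ranges

variable {R H A : Type*} [CommRing R] [Ring H] [HopfAlgebra R H] [Ring A] [Algebra R A]
  {ω : WeakAction R H A} {σ : InvertibleCochain R H A} (hσ : IsCrossedProduct ω σ.map)

/-- The linear map `A ⊗ H ⊗ U → Hom_R(H, A ⊗ H)`, `a ⊗ h ⊗ f ↦ [k ↦ a ⊗ (f ⇀ k) h]`. -/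
def plainMap (A : Type*) [Ring A] [Algebra R A] (U : Submodule R (Module.Dual R H)) :
    (A ⊗[R] H) ⊗[R] U →ₗ[R] (H →ₗ[R] A ⊗[R] H) :=
  convLeft (Algebra.TensorProduct.includeRight (R := R) (A := A) (B := H)).toLinearMap ∘ₗ
    alphaMap U (A ⊗[R] H)

theorem plainMap_tmul (U : Submodule R (Module.Dual R H)) (a : A) (h : H) (f : U) (k : H) :
    plainMap A U ((a ⊗ₜ h) ⊗ₜ f) k = a ⊗ₜ (leftHit f.1 k * h) := by
  rw [plainMap, LinearMap.comp_apply, convLeft_apply_smul _ _ _ f.1 (alphaMap_tmul U _ f)]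
  simp

theorem plainMap_injective {U : Submodule R (Module.Dual R H)}
    (hU : Function.Injective (alphaMap U (A ⊗[R] H))) : Function.Injective (plainMap A U) :=
  (convLeft_injective (algHom_antipode_convMul _)).comp hU

/-- The linear map `(A #_σ H) ⊗ U → Hom_R(H, A #_σ H)`, `x ⊗ f ↦ [k ↦ (1 # (f ⇀ k)) x]`. -/
def crossedMap (U : Submodule R (Module.Dual R H)) :
    (A ⊗[R] H) ⊗[R] U →ₗ[R] (H →ₗ[R] CrossedProduct hσ) :=
  convLeft (CrossedProduct.sect hσ) ∘ₗ
    LinearMap.compRight R (CrossedProduct.mk hσ).toLinearMap ∘ₗ alphaMap U (A ⊗[R] H)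

theorem crossedMap_tmul (U : Submodule R (Module.Dual R H)) (x : A ⊗[R] H) (f : U) (k : H) :
    crossedMap hσ U (x ⊗ₜ f) k =
      CrossedProduct.sect hσ (leftHit f.1 k) * CrossedProduct.mk hσ x := by
  rw [crossedMap, LinearMap.comp_apply, convLeft_apply_smul _ _ (CrossedProduct.mk hσ x) f.1]
  intro k
  simp [alphaMap_tmul]

theorem crossedMap_injective {U : Submodule R (Module.Dual R H)}
    (hU : Function.Injective (alphaMap U (A ⊗[R] H))) : Function.Injective (crossedMap hσ U) := by
  have h1 : Function.Injective (LinearMap.compRight R (M := H)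
      (CrossedProduct.mk hσ).toLinearMap) := fun F G hFG =>
    LinearMap.ext fun k => (CrossedProduct.mk hσ).injective congr($hFG k)
  exact (convLeft_injective (CrossedProduct.sectInv_mul_sect hσ)).comp (h1.comp hU)

variable (U : LeftModuleSubalgebra R H)

/-- Since `g ⇀ (f ⇀ k) = (g ⋆ f) ⇀ k` and `U` is closed under `⋆`, precomposition with `f ⇀ (-)` is
absorbed into the `U`-factor. -/
theorem exists_plainMap_leftHit (t : (A ⊗[R] H) ⊗[R] U.toSubmodule) (f : U.toSubmodule) :
    ∃ s, ∀ k, plainMap A U.toSubmodule t (leftHit f.1 k) = plainMap A U.toSubmodule s k := by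
  refine ⟨(U.actMulAux 1 f).lTensor _ t, fun k => ?_⟩
  induction t with
  | zero => simp
  | add x y hx hy => simp only [map_add, LinearMap.add_apply, hx, hy]
  | tmul x g =>
    induction x with
    | zero => simp
    | add x y hx hy => simp only [TensorProduct.add_tmul, map_add, LinearMap.add_apply, hx, hy]
    | tmul a h =>
      rw [LinearMap.lTensor_tmul, plainMap_tmul, plainMap_tmul, U.coe_actMulAux, dualAct_one,
        leftHit_dualMul]

theorem exists_crossedMap_leftHit (t : (A ⊗[R] H) ⊗[R] U.toSubmodule) (f : U.toSubmodule) :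
    ∃ s, ∀ k, crossedMap hσ U.toSubmodule t (leftHit f.1 k) =
      crossedMap hσ U.toSubmodule s k := by
  refine ⟨(U.actMulAux 1 f).lTensor _ t, fun k => ?_⟩
  induction t with
  | zero => simp
  | add x y hx hy => simp only [map_add, LinearMap.add_apply, hx, hy]
  | tmul x g =>
    rw [LinearMap.lTensor_tmul, crossedMap_tmul, crossedMap_tmul, U.coe_actMulAux, dualAct_one,
      leftHit_dualMul]

/-- For `a ⊗ v` the left side is `a ⊗ (k ↼ v) h`, to which the RL-condition applies directly. -/
theorem exists_map_alphaMap_eq_plainMap {V W : Submodule R (Module.Dual R H)}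
    (hVW : RLCondition V W) (t : A ⊗[R] V) (h : H) :
    ∃ s, ∀ k : H, TensorProduct.map (alphaMap V A t) (LinearMap.mulRight R h)
      (Coalgebra.comul k) = plainMap A W s k := by
  induction t with
  | zero => exact ⟨0, by simp⟩
  | add x y hx hy =>
    obtain ⟨s, hs⟩ := hx
    obtain ⟨s', hs'⟩ := hy
    exact ⟨s + s', fun k => by
      rw [map_add, map_add, TensorProduct.map_add_left, LinearMap.add_apply, hs, hs',
        LinearMap.add_apply]⟩
  | tmul a v =>
    obtain ⟨n, l, f, hf, hl⟩ := hVW v v.2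
    refine ⟨∑ j, (a ⊗ₜ (l j * h)) ⊗ₜ ⟨f j, hf j⟩, fun k => ?_⟩
    have h1 : TensorProduct.map (alphaMap V A (a ⊗ₜ v)) (LinearMap.mulRight R h)
        (Coalgebra.comul k) = a ⊗ₜ (rightHit v.1 k * h) := by
      rw [rightHit, LinearMap.comp_apply, LinearMap.comp_apply]
      induction Coalgebra.comul (R := R) k with
      | zero => simp
      | add y z hy hz => simp only [map_add, hy, hz, add_mul, TensorProduct.tmul_add]
      | tmul y z => simp [alphaMap_tmul, TensorProduct.smul_tmul]
    rw [h1, hl, map_sum, LinearMap.sum_apply, Finset.sum_mul, TensorProduct.tmul_sum]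
    simp only [plainMap_tmul, mul_assoc]

theorem antipode_convMul_leftHit (f : Module.Dual R H) :
    toConv (HopfAlgebra.antipode R) * toConv (leftHit f) = toConv (Algebra.linearMap R H ∘ₗ f) := by
  rw [leftHit_eq_convMul, ← mul_assoc, LinearMap.antipode_mul_id, one_mul]

/-- For `a ⊗ v` the value is `a ⊗ ∑ S(k₁)(k₂ ↼ v) h`. The RL-condition replaces `k₂ ↼ v` by `∑ (f_j
⇀ k₂) l_j`, and the antipode then collapses each term to the scalar `f_j(k)` times `l_j h`. -/
theorem exists_sandwichMul_alphaMap_eq_alphaMap {V W : Submodule R (Module.Dual R H)}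
    (hVW : RLCondition V W) (t : A ⊗[R] V) (h : H) :
    ∃ s, ∀ k : H, sandwichMul (alphaMap V A t) h k = alphaMap W (A ⊗[R] H) s k := by
  induction t with
  | zero => exact ⟨0, by simp [sandwichMul, sandwich]⟩
  | add x y hx hy =>
    obtain ⟨s, hs⟩ := hx
    obtain ⟨s', hs'⟩ := hy
    refine ⟨s + s', fun k => ?_⟩
    rw [map_add, map_add, LinearMap.add_apply, ← hs, ← hs']
    simp [sandwichMul, sandwich, TensorProduct.map_add_left]
  | tmul a v =>
    obtain ⟨n, l, f, hf, hl⟩ := hVW v v.2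
    refine ⟨∑ j, (a ⊗ₜ (l j * h)) ⊗ₜ ⟨f j, hf j⟩, fun k => ?_⟩
    have h1 : sandwichMul (alphaMap V A (a ⊗ₜ v)) h k =
        a ⊗ₜ ((toConv (HopfAlgebra.antipode R) * toConv (rightHit v.1)).ofConv k * h) := by
      rw [LinearMap.convMul_apply, sandwichMul, sandwich]
      simp only [LinearMap.comp_apply]
      induction Coalgebra.comul (R := R) k with
      | zero => simp
      | add y z hy hz => simp only [map_add, hy, hz, add_mul, TensorProduct.tmul_add]
      | tmul x y =>
        simp only [LinearMap.lTensor_tmul, TensorProduct.map_tmul, rightHit, LinearMap.comp_apply]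
        induction Coalgebra.comul (R := R) y with
        | zero => simp
        | add y z hy hz => simp only [map_add, hy, hz, add_mul, TensorProduct.tmul_add]
        | tmul y z => simp [alphaMap_tmul, TensorProduct.smul_tmul, mul_assoc]
    have h2 : toConv (rightHit v.1) =
        ∑ j, toConv (LinearMap.mulRight R (l j) ∘ₗ leftHit (f j)) := by
      ext k
      rw [ofConv_sum, LinearMap.sum_apply]
      exact hl k
    have h3 (j : Fin n) : toConv (HopfAlgebra.antipode R) *
        toConv (LinearMap.mulRight R (l j) ∘ₗ leftHit (f j)) =
          toConv (LinearMap.mulRight R (l j) ∘ₗ Algebra.linearMap R H ∘ₗ f j) := by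
      ext k
      have := congr($(antipode_convMul_leftHit (f j)).ofConv k * l j)
      refine Eq.trans ?_ this
      rw [(Coalgebra.Repr.arbitrary R k).convMul_apply,
        (Coalgebra.Repr.arbitrary R k).convMul_apply, Finset.sum_mul]
      simp [mul_assoc]
    rw [h1, h2, Finset.mul_sum, ofConv_sum, LinearMap.sum_apply, Finset.sum_mul,
      TensorProduct.tmul_sum, map_sum, LinearMap.sum_apply]
    simp [h3, alphaMap_tmul, Algebra.algebraMap_eq_smul_one]

variable {U} {V : Submodule R (Module.Dual R H)}

/-- For `(a # h) ⊗ f` the value is `γ(f ⇀ k)(a # h)`. Expand it by `phiLift_eq`, apply the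
RL-condition to the `φ`-terms, and absorb `f ⇀ (-)`. -/
theorem exists_plainMap_eq_crossedMap (hVU : IsCompatible ω σ V U.toSubmodule)
    (t : (A ⊗[R] H) ⊗[R] U.toSubmodule) :
    ∃ s, ∀ k, CrossedProduct.mk hσ (plainMap A U.toSubmodule s k) =
      crossedMap hσ U.toSubmodule t k := by
  induction t with
  | zero => exact ⟨0, by simp⟩
  | add x y hx hy =>
    obtain ⟨s, hs⟩ := hx
    obtain ⟨s', hs'⟩ := hy
    exact ⟨s + s', fun k => by simp only [map_add, LinearMap.add_apply, hs, hs']⟩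
  | tmul x f =>
    induction x with
    | zero => exact ⟨0, by simp⟩
    | add x y hx hy =>
      obtain ⟨s, hs⟩ := hx
      obtain ⟨s', hs'⟩ := hy
      exact ⟨s + s', fun k => by
        simp only [map_add, TensorProduct.add_tmul, LinearMap.add_apply, hs, hs']⟩
    | tmul a h =>
      have h1 (i : H × H) : ∃ s, ∀ k : H,
          TensorProduct.map (phiMap ω σ ((Coalgebra.Repr.arbitrary R h).left i) a)
            (LinearMap.mulRight R ((Coalgebra.Repr.arbitrary R h).right i)) (Coalgebra.comul k) =
              plainMap A U.toSubmodule s k := by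
        obtain ⟨t, ht⟩ := hVU.phi_mem ((Coalgebra.Repr.arbitrary R h).left i) a
        rw [← ht]
        exact exists_map_alphaMap_eq_plainMap hVU.rl t _
      choose s hs using h1
      obtain ⟨s', hs'⟩ := exists_plainMap_leftHit (A := A) U
        (∑ i ∈ (Coalgebra.Repr.arbitrary R h).index, s i) f
      refine ⟨s', fun k => ?_⟩
      rw [← hs', crossedMap_tmul, CrossedProduct.mk_tmul]
      refine Eq.trans ?_ (CrossedProduct.phiLift_eq hσ h a (leftHit f.1 k)).symm
      simp only [hs, map_sum, LinearMap.sum_apply]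

/-- By `psiLift_eq` and the RL-condition, `psiLift` lies in the image of `α`. Convolving it with `γ`
yields `k ↦ a # k h`, in which `k` is finally replaced by `f ⇀ k`. -/
theorem exists_crossedMap_eq_plainMap (hVU : IsCompatible ω σ V U.toSubmodule)
    (t : (A ⊗[R] H) ⊗[R] U.toSubmodule) :
    ∃ s, ∀ k, crossedMap hσ U.toSubmodule s k =
      CrossedProduct.mk hσ (plainMap A U.toSubmodule t k) := by
  induction t with
  | zero => exact ⟨0, by simp⟩
  | add x y hx hy =>
    obtain ⟨s, hs⟩ := hx
    obtain ⟨s', hs'⟩ := hy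
    exact ⟨s + s', fun k => by simp only [map_add, LinearMap.add_apply, hs, hs']⟩
  | tmul x f =>
    induction x with
    | zero => exact ⟨0, by simp⟩
    | add x y hx hy =>
      obtain ⟨s, hs⟩ := hx
      obtain ⟨s', hs'⟩ := hy
      exact ⟨s + s', fun k => by
        simp only [map_add, TensorProduct.add_tmul, LinearMap.add_apply, hs, hs']⟩
    | tmul a h =>
      have h1 (i : H × H) : ∃ s, ∀ k : H,
          sandwichMul (psiMap ω σ ((Coalgebra.Repr.arbitrary R h).left i) a)
            ((Coalgebra.Repr.arbitrary R h).right i) k =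
              alphaMap U.toSubmodule (A ⊗[R] H) s k := by
        obtain ⟨t, ht⟩ := hVU.psi_mem ((Coalgebra.Repr.arbitrary R h).left i) a
        rw [← ht]
        exact exists_sandwichMul_alphaMap_eq_alphaMap hVU.rl t _
      choose s hs using h1
      obtain ⟨s', hs'⟩ := exists_crossedMap_leftHit hσ U
        (∑ i ∈ (Coalgebra.Repr.arbitrary R h).index, s i) f
      refine ⟨s', fun k => ?_⟩
      rw [← hs', plainMap_tmul, ← CrossedProduct.sect_convMul_psiLift]
      have h2 : CrossedProduct.psiLift hσ h a = (CrossedProduct.mk hσ).toLinearMap ∘ₗ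
          alphaMap U.toSubmodule (A ⊗[R] H) (∑ i ∈ (Coalgebra.Repr.arbitrary R h).index, s i) := by
        ext k
        rw [CrossedProduct.psiLift_eq]
        simp only [hs, map_sum, LinearMap.sum_apply, LinearMap.comp_apply]
        rfl
      rw [h2]
      rfl

theorem range_crossedMap (hVU : IsCompatible ω σ V U.toSubmodule) :
    LinearMap.range (LinearMap.compRight R (CrossedProduct.mk hσ).symm.toLinearMap ∘ₗ
      crossedMap hσ U.toSubmodule) = LinearMap.range (plainMap A U.toSubmodule) := by
  apply le_antisymm
  · rintro _ ⟨t, rfl⟩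
    obtain ⟨s, hs⟩ := exists_plainMap_eq_crossedMap hσ hVU t
    refine ⟨s, LinearMap.ext fun k => ?_⟩
    simp [← hs]
  · rintro _ ⟨t, rfl⟩
    obtain ⟨s, hs⟩ := exists_crossedMap_eq_plainMap hσ hVU t
    refine ⟨s, LinearMap.ext fun k => ?_⟩
    simp [hs]

end Ranges

/-! ### The algebra `L` and the isomorphism -/

section Duality

variable {R H A : Type*} [CommRing R] [Ring H] [HopfAlgebra R H] [Ring A] [Algebra R A]

/-- `h ⊗ f ↦ [k ↦ (f ⇀ k) h]`. -/
def hitMul (U : Submodule R (Module.Dual R H)) : H ⊗[R] U →ₗ[R] Module.End R H :=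
  TensorProduct.lift (LinearMap.mk₂ R (fun h f => LinearMap.mulRight R h ∘ₗ leftHit f.1)
    (fun h h' f => by ext; simp [mul_add])
    (fun c h f => by ext; simp)
    (fun h f g => by ext; simp [leftHit_add, add_mul])
    (fun c h f => by ext; simp [leftHit_smul]))

theorem hitMul_tmul (U : Submodule R (Module.Dual R H)) (h : H) (f : U) (k : H) :
    hitMul U (h ⊗ₜ f) k = leftHit f.1 k * h := rfl

theorem exists_hitMul_eq_mul (U : LeftModuleSubalgebra R H) (s t : H ⊗[R] U.toSubmodule) :
    ∃ r, hitMul U.toSubmodule r = hitMul U.toSubmodule s * hitMul U.toSubmodule t := by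
  induction s with
  | zero => exact ⟨0, by simp⟩
  | add x y hx hy =>
    obtain ⟨r, hr⟩ := hx
    obtain ⟨r', hr'⟩ := hy
    exact ⟨r + r', by rw [map_add, hr, hr', map_add, add_mul]⟩
  | tmul h f =>
    induction t with
    | zero => exact ⟨0, by simp⟩
    | add x y hx hy =>
      obtain ⟨r, hr⟩ := hx
      obtain ⟨r', hr'⟩ := hy
      exact ⟨r + r', by rw [map_add, hr, hr', map_add, mul_add]⟩
    | tmul l g =>
      -- The composite sends `k` to `(f ⇀ ((g ⇀ k) l)) h = ∑ (((l₂ f) ⋆ g) ⇀ k) l₁ h`.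
      refine ⟨∑ i ∈ (Coalgebra.Repr.arbitrary R l).index,
        ((Coalgebra.Repr.arbitrary R l).left i * h) ⊗ₜ
          U.actMulAux ((Coalgebra.Repr.arbitrary R l).right i) g f, ?_⟩
      ext k
      rw [Module.End.mul_apply, hitMul_tmul, hitMul_tmul, leftHit_mul, map_sum,
        LinearMap.sum_apply, Finset.sum_mul]
      simp only [hitMul_tmul, U.coe_actMulAux, leftHit_dualMul, mul_assoc]

/-- The subalgebra of `End_R(H)^op` of all `k ↦ ∑ (f ⇀ k) h` with `h ∈ H`, `f ∈ U`. -/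
def hitSubalgebra (U : LeftModuleSubalgebra R H) :
    NonUnitalSubalgebra R (Module.End R H)ᵐᵒᵖ where
  carrier := {F | F.unop ∈ LinearMap.range (hitMul U.toSubmodule)}
  zero_mem' := (LinearMap.range (hitMul U.toSubmodule)).zero_mem
  add_mem' hF hG := (LinearMap.range (hitMul U.toSubmodule)).add_mem hF hG
  smul_mem' c F hF := (LinearMap.range (hitMul U.toSubmodule)).smul_mem c hF
  mul_mem' := by
    rintro F G ⟨s, hs⟩ ⟨t, ht⟩
    -- The arguments are swapped because multiplication in the opposite algebra reverses
    -- composition.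
    obtain ⟨r, hr⟩ := exists_hitMul_eq_mul U t s
    exact ⟨r, by rw [hr, hs, ht, MulOpposite.unop_mul]⟩

/-- `hitMul` with values in `hitSubalgebra`. -/
def toHitSubalgebra (U : LeftModuleSubalgebra R H) :
    H ⊗[R] U.toSubmodule →ₗ[R] hitSubalgebra U where
  toFun t := ⟨MulOpposite.op (hitMul U.toSubmodule t), t, rfl⟩
  map_add' s t := Subtype.ext congr(MulOpposite.op $(map_add (hitMul U.toSubmodule) s t))
  map_smul' c t := Subtype.ext congr(MulOpposite.op $(map_smul (hitMul U.toSubmodule) c t))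

theorem toHitSubalgebra_surjective (U : LeftModuleSubalgebra R H) :
    Function.Surjective (toHitSubalgebra U) := by
  rintro ⟨F, t, ht⟩
  exact ⟨t, Subtype.ext (MulOpposite.unop_injective ht)⟩

variable (A) in
/-- `a ⊗ l ↦ [k ↦ a ⊗ l(k)]`. -/
def tensorEval (U : LeftModuleSubalgebra R H) :
    A ⊗[R] hitSubalgebra U →ₗ[R] (H →ₗ[R] A ⊗[R] H) :=
  TensorProduct.lift (LinearMap.mk₂ R (fun a l => TensorProduct.mk R A H a ∘ₗ l.1.unop)
    (fun a b l => by ext; simp)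
    (fun c a l => by ext; simp [TensorProduct.smul_tmul'])
    (fun a l l' => by ext; simp [TensorProduct.tmul_add])
    (fun c a l => by ext; simp))

theorem tensorEval_tmul (U : LeftModuleSubalgebra R H) (a : A) (l : hitSubalgebra U) (k : H) :
    tensorEval A U (a ⊗ₜ l) k = a ⊗ₜ l.1.unop k := rfl

theorem tensorEval_comp (U : LeftModuleSubalgebra R H) (t : (A ⊗[R] H) ⊗[R] U.toSubmodule) :
    tensorEval A U ((toHitSubalgebra U).lTensor A
      (TensorProduct.assoc R A H U.toSubmodule t)) = plainMap A U.toSubmodule t := by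
  rw [← LinearEquiv.coe_coe, ← LinearMap.comp_apply, ← LinearMap.comp_apply]
  congr 1
  refine TensorProduct.ext_threefold fun a h f => LinearMap.ext fun k => ?_
  rw [plainMap_tmul]
  rfl

theorem lTensor_toHitSubalgebra_surjective (U : LeftModuleSubalgebra R H) :
    Function.Surjective ((toHitSubalgebra U).lTensor A ∘ₗ
      (TensorProduct.assoc R A H U.toSubmodule).toLinearMap) :=
  (LinearMap.lTensor_surjective A (toHitSubalgebra_surjective U)).comp
    (TensorProduct.assoc R A H U.toSubmodule).surjective

/-- `plainMap` is `tensorEval` after the surjection `A ⊗ H ⊗ U → A ⊗ L`, so injectivity of the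
composite suffices. No flatness of `A` is needed. -/
theorem tensorEval_injective {U : LeftModuleSubalgebra R H}
    (hU : Function.Injective (alphaMap U.toSubmodule (A ⊗[R] H))) :
    Function.Injective (tensorEval A U) := by
  intro s t hst
  obtain ⟨s, rfl⟩ := lTensor_toHitSubalgebra_surjective U s
  obtain ⟨t, rfl⟩ := lTensor_toHitSubalgebra_surjective U t
  refine congrArg _ (plainMap_injective hU ?_)
  rwa [← tensorEval_comp, ← tensorEval_comp]

theorem range_tensorEval (U : LeftModuleSubalgebra R H) :
    LinearMap.range (tensorEval A U) = LinearMap.range (plainMap A U.toSubmodule) := by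
  apply le_antisymm
  · rintro _ ⟨t, rfl⟩
    obtain ⟨t, rfl⟩ := lTensor_toHitSubalgebra_surjective U t
    exact ⟨t, (tensorEval_comp U t).symm⟩
  · rintro _ ⟨t, rfl⟩
    exact ⟨_, tensorEval_comp U t⟩

/-- The left `A`-linear extension `a ⊗ k ↦ a G(k)` of `G : H → A ⊗ H`. -/
def extend (G : H →ₗ[R] A ⊗[R] H) : A ⊗[R] H →ₗ[R] A ⊗[R] H :=
  leftMul R H A ∘ₗ G.lTensor A

theorem extend_tmul (G : H →ₗ[R] A ⊗[R] H) (a : A) (k : H) :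
    extend G (a ⊗ₜ k) = leftMul R H A (a ⊗ₜ G k) := rfl

theorem extend_add (F G : H →ₗ[R] A ⊗[R] H) (x : A ⊗[R] H) :
    extend (F + G) x = extend F x + extend G x := by
  simp [extend, LinearMap.lTensor_add]

theorem extend_zero (x : A ⊗[R] H) : extend (0 : H →ₗ[R] A ⊗[R] H) x = 0 := by
  simp [extend]

theorem tensorEval_mul (U : LeftModuleSubalgebra R H) (s t : A ⊗[R] hitSubalgebra U) (k : H) :
    tensorEval A U (s * t) k = extend (tensorEval A U t) (tensorEval A U s k) := by
  induction s with
  | zero => simp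
  | add x y hx hy => simp only [add_mul, map_add, LinearMap.add_apply, hx, hy]
  | tmul a l =>
    induction t with
    | zero => simp [extend_zero]
    | add x y hx hy => simp only [mul_add, map_add, LinearMap.add_apply, hx, hy, extend_add]
    | tmul b m =>
      rw [Algebra.TensorProduct.tmul_mul_tmul, tensorEval_tmul, tensorEval_tmul, extend_tmul,
        tensorEval_tmul, leftMul_tmul]
      rfl

variable {ω : WeakAction R H A} {σ : InvertibleCochain R H A} (hσ : IsCrossedProduct ω σ.map)

theorem mk_extend_crossedMap (U : Submodule R (Module.Dual R H)) (y : A ⊗[R] H) (f : U)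
    (z : A ⊗[R] H) :
    CrossedProduct.mk hσ (extend ((CrossedProduct.mk hσ).symm.toLinearMap ∘ₗ
      crossedMap hσ U (y ⊗ₜ f)) z) =
        TensorProduct.rid R _ (f.1.lTensor _ (CrossedProduct.coact hσ (CrossedProduct.mk hσ z))) *
          CrossedProduct.mk hσ y := by
  induction z with
  | zero => simp
  | add x y hx hy => simp only [map_add, hx, hy, add_mul]
  | tmul a k =>
    have h1 : TensorProduct.rid R _ (f.1.lTensor _ (CrossedProduct.coact hσ
        (CrossedProduct.incl hσ a * CrossedProduct.sect hσ k))) =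
          CrossedProduct.incl hσ a * CrossedProduct.sect hσ (leftHit f.1 k) := by
      rw [CrossedProduct.coact_incl_mul_sect, leftHit, LinearMap.comp_apply, LinearMap.comp_apply,
        ← (Coalgebra.Repr.arbitrary R k).eq]
      simp [Finset.mul_sum]
    rw [extend_tmul, CrossedProduct.mk_tmul, h1, mul_assoc, ← crossedMap_tmul,
      ← CrossedProduct.incl_mul_mk]
    simp

/-- Acting first by `x # f` and then by `y # g` gives `(g ⇀ ((f ⇀ z) x)) y`. Multiplicativity of the
coaction rewrites this as `∑ (((x₁ g) ⋆ f) ⇀ z) x₀ y`, which is the product rule of `B #^op U`. By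
`A`-linearity it is enough to treat `z = 1 # k`. -/
theorem crossedMap_smashOpMul (U : LeftModuleSubalgebra R H)
    (s t : (A ⊗[R] H) ⊗[R] U.toSubmodule) (k : H) :
    (CrossedProduct.mk hσ).symm (crossedMap hσ U.toSubmodule
      (smashOpMul (crossedMul ω σ.map) (crossedCoaction R H A) U (s ⊗ₜ t)) k) =
      extend ((CrossedProduct.mk hσ).symm.toLinearMap ∘ₗ crossedMap hσ U.toSubmodule t)
        ((CrossedProduct.mk hσ).symm (crossedMap hσ U.toSubmodule s k)) := by
  induction t with
  | zero => simp [extend_zero]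
  | add x y hx hy =>
    simp only [TensorProduct.tmul_add, map_add, LinearMap.add_apply, hx, hy, LinearMap.comp_add,
      extend_add]
  | tmul y g =>
    induction s with
    | zero => simp
    | add x y hx hy => simp only [TensorProduct.add_tmul, map_add, LinearMap.add_apply, hx, hy]
    | tmul x f =>
      induction x with
      | zero => simp
      | add x y hx hy => simp only [TensorProduct.add_tmul, map_add, LinearMap.add_apply, hx, hy]
      | tmul a h =>
        have h1 : smashOpMul (crossedMul ω σ.map) (crossedCoaction R H A) U
            (((a ⊗ₜ h) ⊗ₜ f) ⊗ₜ (y ⊗ₜ g)) = ∑ i ∈ (Coalgebra.Repr.arbitrary R h).index,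
              crossedMul ω σ.map ((a ⊗ₜ (Coalgebra.Repr.arbitrary R h).left i) ⊗ₜ y) ⊗ₜ
                U.actMulAux ((Coalgebra.Repr.arbitrary R h).right i) f g := by
          simp only [smashOpMul, LinearMap.comp_apply, LinearMap.rTensor_tmul,
            crossedCoaction_tmul, TensorProduct.sum_tmul, map_sum, LinearEquiv.coe_coe,
            TensorProduct.assoc_tmul, TensorProduct.tensorTensorTensorComm_tmul,
            TensorProduct.map_tmul]
          rfl
        apply (CrossedProduct.mk hσ).injective
        rw [mk_extend_crossedMap, LinearEquiv.apply_symm_apply, LinearEquiv.apply_symm_apply,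
          crossedMap_tmul, CrossedProduct.coact_mul,
          CrossedProduct.mk_tmul, CrossedProduct.coact_incl_mul_sect, h1, Finset.mul_sum,
          map_sum, map_sum, map_sum, Finset.sum_mul, LinearMap.sum_apply]
        refine Finset.sum_congr rfl fun i _ => ?_
        rw [rid_lTensor_mul_tmul, crossedMap_tmul, U.coe_actMulAux, leftHit_dualMul,
          ← CrossedProduct.mk_mul_mk, CrossedProduct.mk_tmul, ← mul_assoc]
        congr 2
        rw [CrossedProduct.coact_sect, leftHit, LinearMap.comp_apply, LinearMap.comp_apply,
          ← (Coalgebra.Repr.arbitrary R (leftHit f.1 k)).eq]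
        simp

variable {U : LeftModuleSubalgebra R H} {V : Submodule R (Module.Dual R H)}

theorem exists_equiv (hσ : IsCrossedProduct ω σ.map)
    (hVU : IsCompatible ω σ V U.toSubmodule)
    (hU : Function.Injective (alphaMap U.toSubmodule (A ⊗[R] H))) :
    ∃ e : (A ⊗[R] H) ⊗[R] U.toSubmodule ≃ₗ[R] A ⊗[R] hitSubalgebra U,
      ∀ t k, tensorEval A U (e t) k =
        (CrossedProduct.mk hσ).symm (crossedMap hσ U.toSubmodule t k) := by
  have h1 : Function.Injective (LinearMap.compRight R (CrossedProduct.mk hσ).symm.toLinearMap ∘ₗ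
      crossedMap hσ U.toSubmodule) := by
    intro s t hst
    refine crossedMap_injective hσ hU (LinearMap.ext fun k => ?_)
    exact (CrossedProduct.mk hσ).symm.injective congr($hst k)
  have h2 := (range_crossedMap hσ hVU).trans (range_tensorEval U).symm
  refine ⟨(LinearEquiv.ofInjective _ h1).trans ((LinearEquiv.ofEq _ _ h2).trans
    (LinearEquiv.ofInjective _ (tensorEval_injective hU)).symm), fun t k => ?_⟩
  have h3 := LinearEquiv.ofInjective_apply (tensorEval A U)
    ((LinearEquiv.ofInjective _ (tensorEval_injective hU)).symm
      ((LinearEquiv.ofEq _ _ h2) ((LinearEquiv.ofInjective _ h1) t))) (h := tensorEval_injective hU)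
  rw [LinearEquiv.apply_symm_apply] at h3
  exact congr($(h3.symm) k)

theorem exists_algebra_equiv (hσ : IsCrossedProduct ω σ.map)
    (hVU : IsCompatible ω σ V U.toSubmodule)
    (hU : Function.Injective (alphaMap U.toSubmodule (A ⊗[R] H))) :
    ∃ e : (A ⊗[R] H) ⊗[R] U.toSubmodule ≃ₗ[R] A ⊗[R] hitSubalgebra U,
      (∀ x y, e (smashOpMul (crossedMul ω σ.map) (crossedCoaction R H A) U (x ⊗ₜ y)) =
        e x * e y) ∧
      ∀ hU : (Coalgebra.counit : Module.Dual R H) ∈ U.toSubmodule, ∃ hL : 1 ∈ hitSubalgebra U,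
        e ((1 ⊗ₜ 1) ⊗ₜ ⟨Coalgebra.counit, hU⟩) = 1 ⊗ₜ ⟨1, hL⟩ := by
  obtain ⟨e, he⟩ := exists_equiv hσ hVU hU
  refine ⟨e, fun x y => tensorEval_injective hU (LinearMap.ext fun k => ?_), fun hε => ?_⟩
  · rw [he, crossedMap_smashOpMul, tensorEval_mul, he]
    congr 2
    ext k
    exact (he y k).symm
  · have hL : 1 ∈ hitSubalgebra U := by
      refine ⟨1 ⊗ₜ ⟨Coalgebra.counit, hε⟩, LinearMap.ext fun k => ?_⟩
      rw [hitMul_tmul, leftHit_counit, mul_one]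
      rfl
    refine ⟨hL, tensorEval_injective hU (LinearMap.ext fun k => ?_)⟩
    rw [he, crossedMap_tmul, leftHit_counit, ← CrossedProduct.one_def, mul_one, tensorEval_tmul,
      CrossedProduct.sect_apply, LinearEquiv.symm_apply_apply]
    rfl

end Duality

/-! ### Density of `L` in `End_R(H)^op` -/

section Density

variable {R H : Type*} [CommRing R] [Ring H] [HopfAlgebra R H]

/-- If `H` is projective and `U ⊆ H*` is dense, then `M ⊗ U` has dense image in `Hom_R(H, M)`. -/
theorem exists_alphaMap_eq_on [Module.Projective R H] {U : Submodule R (Module.Dual R H)}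
    (hU : IsDenseIn (U : Set (Module.Dual R H)) Set.univ) {M : Type*} [AddCommGroup M] [Module R M]
    (F : H →ₗ[R] M) (s : Finset H) : ∃ t, ∀ k ∈ s, alphaMap U M t k = F k := by
  obtain ⟨g, hg⟩ := Module.projective_def.1 (inferInstance : Module.Projective R H)
  classical
  -- Projectivity gives a section `g` of `(H →₀ R) → H`. Its coordinate functionals, a dual basis,
  -- are replaced by elements of `U` that agree with them on the finite set `s`.
  choose u hu hus using fun x : H =>
    (isDenseIn_iff _ _).1 hU (Finsupp.lapply x ∘ₗ g) (Set.mem_univ _) s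
  refine ⟨∑ x ∈ s.biUnion fun k => (g k).support, F x ⊗ₜ ⟨u x, hu x⟩, fun k hk => ?_⟩
  have h1 : F k = (g k).sum fun x c => c • F x := by
    conv_lhs => rw [← hg k, Finsupp.linearCombination_apply, map_finsuppSum]
    simp
  rw [h1, Finsupp.sum_of_support_subset (g k)
    (Finset.subset_biUnion_of_mem (fun k => (g k).support) hk) _ (by simp)]
  rw [map_sum, LinearMap.sum_apply]
  refine Finset.sum_congr rfl fun x _ => ?_
  rw [alphaMap_tmul, hus x k hk]
  rfl

theorem hitMul_eq_convLeft (U : Submodule R (Module.Dual R H)) (t : H ⊗[R] U) :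
    hitMul U t = convLeft LinearMap.id (alphaMap U H t) := by
  induction t with
  | zero => simp
  | add x y hx hy => simp only [map_add, hx, hy]
  | tmul h f =>
    ext k
    rw [hitMul_tmul, convLeft_apply_smul _ _ _ f.1 (alphaMap_tmul U h f)]
    rfl

theorem isDenseIn_hitSubalgebra [Module.Projective R H] {U : LeftModuleSubalgebra R H}
    (hU : IsDenseIn (U.toSubmodule : Set (Module.Dual R H)) Set.univ) :
    IsDenseIn {f : H →ₗ[R] H | MulOpposite.op (f : Module.End R H) ∈ hitSubalgebra U}
      Set.univ := by
  rw [isDenseIn_iff]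
  intro G _ s
  classical
  -- Since `G = id * (S * G)`, it suffices to approximate `S * G` on the finitely many right legs of
  -- the coproducts of the elements of `s`.
  obtain ⟨t, ht⟩ := exists_alphaMap_eq_on hU (convLeft (HopfAlgebra.antipode R) G)
    (s.biUnion fun k => (Coalgebra.Repr.arbitrary R k).index.image
      (Coalgebra.Repr.arbitrary R k).right)
  refine ⟨hitMul U.toSubmodule t, ⟨t, rfl⟩, fun k hk => ?_⟩
  have h1 : convLeft LinearMap.id (convLeft (HopfAlgebra.antipode R) G) = G := by
    rw [convLeft_apply, convLeft_apply, toConv_ofConv, ← mul_assoc, LinearMap.id_mul_antipode,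
      one_mul]
  conv_rhs => rw [← h1]
  rw [hitMul_eq_convLeft, convLeft_apply, convLeft_apply LinearMap.id,
    (Coalgebra.Repr.arbitrary R k).convMul_apply, (Coalgebra.Repr.arbitrary R k).convMul_apply]
  refine Finset.sum_congr rfl fun i hi => ?_
  congr 1
  exact ht _ (Finset.mem_biUnion.2 ⟨k, hk, Finset.mem_image_of_mem _ hi⟩)

theorem hasDenseDuality {A : Type*} [Ring A] [Algebra R A] [Module.Projective R H]
    {ω : WeakAction R H A} {σ : InvertibleCochain R H A} (hσ : IsCrossedProduct ω σ.map)
    {U : LeftModuleSubalgebra R H} {V : Submodule R (Module.Dual R H)}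
    (hVU : IsCompatible ω σ V U.toSubmodule)
    (hU : IsDenseIn (U.toSubmodule : Set (Module.Dual R H)) Set.univ)
    (hα : Function.Injective (alphaMap U.toSubmodule (A ⊗[R] H))) :
    HasDenseDuality ω σ U :=
  ⟨hitSubalgebra U, isDenseIn_hitSubalgebra hU, exists_algebra_equiv hσ hVU hα⟩

end Density

/-! ### Injectivity of `α` over a Noetherian ring -/

section Purity

variable {R : Type*} [CommRing R]

/-- `m ⊗ f ↦ [x ↦ f(x) m]`. -/
def evalTensor (R X M : Type*) [CommRing R] [AddCommGroup M] [Module R M] :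
    M ⊗[R] (X → R) →ₗ[R] (X → M) :=
  TensorProduct.lift (LinearMap.mk₂ R (fun m f x => f x • m)
    (fun m m' f => by ext; simp)
    (fun c m f => by ext x; exact smul_comm (f x) c m)
    (fun m f g => by ext; simp [add_smul])
    (fun c m f => by ext; simp [mul_smul]))

theorem evalTensor_tmul {X M : Type*} [AddCommGroup M] [Module R M] (m : M) (f : X → R) (x : X) :
    evalTensor R X M (m ⊗ₜ f) x = f x • m := rfl

/-- Over a Noetherian ring, `M ⊗ R^X → M^X` is injective for every module `M`. -/
theorem evalTensor_injective [IsNoetherianRing R] (X M : Type*) [AddCommGroup M] [Module R M] :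
    Function.Injective (evalTensor R X M) := by
  rw [injective_iff_map_eq_zero]
  intro t ht
  obtain ⟨k, m, f, rfl⟩ := TensorProduct.exists_sum_tmul_eq t
  -- The relations among the `m j` have finitely many generators `κ`. If the image vanishes, every
  -- vector `(f j x)_j` is a relation; choosing its coefficients in `κ` pointwise in `x` gives
  -- functions on `X`, so the relations can be moved across the tensor sign.
  have h1 : (LinearMap.ker (Fintype.linearCombination R m)).FG := IsNoetherian.noetherian _
  obtain ⟨n, κ, hκ⟩ := Submodule.fg_iff_exists_fin_generating_family.1 h1
  have h2 (x : X) : (fun j => f j x) ∈ Submodule.span R (Set.range κ) := by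
    rw [hκ, LinearMap.mem_ker, Fintype.linearCombination_apply]
    have := congrFun ht x
    rwa [map_sum, Finset.sum_apply] at this
  simp only [Submodule.mem_span_range_iff_exists_fun] at h2
  choose c hc using h2
  have h3 (j : Fin k) : f j = ∑ i, κ i j • fun x => c x i := by
    ext x
    have := congrFun (hc x) j
    simp only [Finset.sum_apply, Pi.smul_apply, smul_eq_mul] at this ⊢
    rw [← this]
    exact Finset.sum_congr rfl fun i _ => mul_comm _ _
  have h4 (i : Fin n) : ∑ j, κ i j • m j = 0 := by
    have : κ i ∈ LinearMap.ker (Fintype.linearCombination R m) :=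
      hκ ▸ Submodule.subset_span ⟨i, rfl⟩
    rwa [LinearMap.mem_ker, Fintype.linearCombination_apply] at this
  calc ∑ j, m j ⊗ₜ[R] f j = ∑ j, ∑ i, (κ i j • m j) ⊗ₜ[R] fun x => c x i := by
        refine Finset.sum_congr rfl fun j _ => ?_
        rw [h3 j, TensorProduct.tmul_sum]
        exact Finset.sum_congr rfl fun i _ => by rw [TensorProduct.smul_tmul]
    _ = 0 := by
        rw [Finset.sum_comm]
        exact Finset.sum_eq_zero fun i _ => by
          rw [← TensorProduct.sum_tmul, h4, TensorProduct.zero_tmul]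

variable {H : Type*} [AddCommGroup H] [Module R H] {U : Submodule R (Module.Dual R H)}

theorem alphaMap_eq_evalTensor {M : Type*} [AddCommGroup M] [Module R M] (t : M ⊗[R] U) (k : H) :
    alphaMap U M t k = evalTensor R H M ((toFunctions U).lTensor M t) k := by
  induction t with
  | zero => simp
  | add x y hx hy => simp only [map_add, LinearMap.add_apply, Pi.add_apply, hx, hy]
  | tmul m f => simp [alphaMap, evalTensor_tmul, toFunctions]

theorem alphaMap_injective_of_lTensor [IsNoetherianRing R] {M : Type*} [AddCommGroup M]
    [Module R M] (hU : Function.Injective ((toFunctions U).lTensor M)) :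
    Function.Injective (alphaMap U M) := fun s t hst =>
  hU (evalTensor_injective H M (funext fun k => by
    rw [← alphaMap_eq_evalTensor, ← alphaMap_eq_evalTensor, hst]))

theorem alphaMap_rTensor {M N : Type*} [AddCommGroup M] [Module R M] [AddCommGroup N] [Module R N]
    (g : M →ₗ[R] N) (t : M ⊗[R] U) (k : H) :
    alphaMap U N (g.rTensor U t) k = g (alphaMap U M t k) := by
  induction t with
  | zero => simp
  | add x y hx hy => simp only [map_add, LinearMap.add_apply, hx, hy]
  | tmul m f => simp [alphaMap]

theorem alphaMap_tensor_injective [IsNoetherianRing R] [Module.Flat R H] {A : Type*}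
    [AddCommGroup A] [Module R A] (hU : IsPureFor (toFunctions U) A) :
    Function.Injective (alphaMap U (A ⊗[R] H)) := by
  apply alphaMap_injective_of_lTensor
  rw [LinearMap.lTensor_inj_iff_rTensor_inj, LinearMap.rTensor_tensor]
  exact (TensorProduct.assoc R _ A H).injective.comp
    ((Module.Flat.rTensor_preserves_injective_linearMap _ hU).comp
      (TensorProduct.assoc R _ A H).symm.injective)

end Purity

/-! ### Purity, and density over a quasi-Frobenius ring -/

section PurityUniverse

universe u

variable {R : Type u} [CommRing R] {H : Type*} [AddCommGroup H] [Module R H]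
  {U : Submodule R (Module.Dual R H)}

/-- A tensor lives over a finitely generated submodule of `M`, which is isomorphic to a quotient of
some `Rⁿ`. Such quotients lie in the universe of `R`, where purity can be tested. -/
theorem alphaMap_injective_of_isPure [IsNoetherianRing R] (hU : IsPure (toFunctions U))
    (M : Type*) [AddCommGroup M] [Module R M] : Function.Injective (alphaMap U M) := by
  rw [injective_iff_map_eq_zero]
  intro t ht
  obtain ⟨M', hM', hs⟩ := TensorProduct.exists_finite_submodule_left_of_setFinite {t}
    (Set.finite_singleton t)
  obtain ⟨t, rfl⟩ := hs rfl
  obtain ⟨n, p, hp⟩ := Module.Finite.exists_fin' R M'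
  let e := p.quotKerEquivOfSurjective hp
  have h1 : Function.Injective (alphaMap U ((Fin n → R) ⧸ LinearMap.ker p)) :=
    alphaMap_injective_of_lTensor ((LinearMap.lTensor_inj_iff_rTensor_inj _ _).2 (hU _))
  have h2 : alphaMap U _ (e.symm.toLinearMap.rTensor U t) = 0 := by
    ext k
    have h3 := congr($ht k)
    rw [alphaMap_rTensor] at h3
    have h4 : alphaMap U M' t k = 0 := Subtype.ext h3
    rw [alphaMap_rTensor, h4]
    exact map_zero e.symm
  have h3 := (injective_iff_map_eq_zero _).1 h1 _ h2
  have h4 : t = e.toLinearMap.rTensor U (e.symm.toLinearMap.rTensor U t) := by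
    rw [← LinearMap.comp_apply, ← LinearMap.rTensor_comp]
    simp
  rw [h4, h3, map_zero, map_zero]

theorem isPure_toFunctions_of_le {W : Submodule R (Module.Dual R H)} (hUW : U ≤ W)
    (hU : IsPure (Submodule.inclusion hUW)) (hW : IsPure (toFunctions W)) :
    IsPure (toFunctions U) := by
  intro N _ _
  have : toFunctions U = toFunctions W ∘ₗ Submodule.inclusion hUW := rfl
  rw [IsPureFor, this, LinearMap.rTensor_comp]
  exact (hW N).comp (hU N)

/-- A proper ideal of a Noetherian self-injective ring has a nonzero annihilator. -/
theorem exists_annihilator_ne_zero [IsQuasiFrobenius R] {J : Ideal R} (hJ : J ≠ ⊤) :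
    ∃ s : R, s ≠ 0 ∧ ∀ x ∈ J, x * s = 0 := by
  by_contra! hc
  obtain ⟨n, x, hx⟩ := Submodule.fg_iff_exists_fin_generating_family.1
    (IsNoetherian.noetherian J)
  -- If no nonzero element annihilates `J`, then `r ↦ r x`, with `x` a finite generating family of
  -- `J`, embeds `R` in `Rⁿ`. Self-injectivity splits this embedding, which expresses `1` as a
  -- combination of the generators.
  have h1 : Function.Injective (LinearMap.toSpanSingleton R (Fin n → R) x) := by
    rw [injective_iff_map_eq_zero]
    intro r hr
    by_contra hr0
    obtain ⟨y, hy, hyr⟩ := hc r hr0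
    rw [← hx, Submodule.mem_span_range_iff_exists_fun] at hy
    obtain ⟨c, rfl⟩ := hy
    refine hyr ?_
    rw [Finset.sum_mul]
    refine Finset.sum_eq_zero fun i _ => ?_
    have : r * x i = 0 := congrFun hr i
    rw [smul_eq_mul, mul_assoc, mul_comm (x i), this, mul_zero]
  obtain ⟨ψ, hψ⟩ := (IsQuasiFrobenius.selfInjective (R := R)).out _ h1 LinearMap.id
  have h2 : ψ x = 1 := by simpa using hψ 1
  refine hJ ((Ideal.eq_top_iff_one J).2 ?_)
  rw [← h2, ← hx, LinearMap.pi_apply_eq_sum_univ ψ x]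
  exact Submodule.sum_mem _ fun i _ => by
    rw [smul_eq_mul, mul_comm]
    exact Submodule.smul_mem _ _ (Submodule.subset_span ⟨i, rfl⟩)

/-- A quasi-Frobenius ring is a cogenerator. -/
theorem exists_dual_ne_zero [IsQuasiFrobenius R] {Q : Type u} [AddCommGroup Q] [Module R Q]
    {q : Q} (hq : q ≠ 0) : ∃ ψ : Module.Dual R Q, ψ q ≠ 0 := by
  let h := LinearMap.toSpanSingleton R Q q
  have hJ : LinearMap.ker h ≠ ⊤ := fun hJ => hq (by
    have : (1 : R) ∈ LinearMap.ker h := hJ ▸ Submodule.mem_top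
    simpa [h] using this)
  obtain ⟨s, hs, hs'⟩ := exists_annihilator_ne_zero hJ
  -- Multiplication by `s` kills the annihilator of `q`, so it induces a map `R q → R` sending `q`
  -- to `s ≠ 0`. Injectivity of `R` extends it to `Q`.
  have hker : LinearMap.ker h ≤ LinearMap.ker (LinearMap.toSpanSingleton R R s) :=
    fun x hx => hs' x hx
  obtain ⟨ψ, hψ⟩ := (IsQuasiFrobenius.selfInjective (R := R)).out
    ((LinearMap.ker h).liftQ h le_rfl)
    (LinearMap.ker_eq_bot.1 (Submodule.ker_liftQ_eq_bot _ _ _ le_rfl))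
    ((LinearMap.ker h).liftQ (LinearMap.toSpanSingleton R R s) hker)
  refine ⟨ψ, ?_⟩
  have h1 : ψ (h 1) = LinearMap.toSpanSingleton R R s 1 := hψ (Submodule.Quotient.mk 1)
  simp only [h, LinearMap.toSpanSingleton_apply, one_smul] at h1
  rwa [h1]

/-- Over a quasi-Frobenius ring, a submodule of `H*` that separates the points of `H` is dense. -/
theorem isDenseIn_of_separates [IsQuasiFrobenius R] (W : Submodule R (Module.Dual R H))
    (hW : ∀ k : H, (∀ f ∈ W, f k = 0) → k = 0) :
    IsDenseIn (W : Set (Module.Dual R H)) Set.univ := by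
  rw [isDenseIn_iff]
  intro f _ s
  let k : Fin s.card → H := fun i => s.equivFin.symm i
  let ev : Module.Dual R H →ₗ[R] (Fin s.card → R) := LinearMap.pi fun i => LinearMap.applyₗ (k i)
  let I : Submodule R (Fin s.card → R) := W.map ev
  suffices h : ev f ∈ I by
    obtain ⟨g, hg, hgf⟩ := h
    refine ⟨g, hg, fun x hx => ?_⟩
    have := congrFun hgf (s.equivFin ⟨x, hx⟩)
    simpa [ev, k] using this
  by_contra hf
  have h1 : I.mkQ (ev f) ≠ 0 := fun h => hf ((Submodule.Quotient.mk_eq_zero I).1 h)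
  obtain ⟨ψ, hψ⟩ := exists_dual_ne_zero (R := R) h1
  -- A functional on `Rⁿ` composed with evaluation at the points `k i` is evaluation at one
  -- combination of these points. If it vanishes on the image of `W`, that combination is zero
  -- because `W` separates points, so the functional also vanishes at `f`.
  have h2 (g : Module.Dual R H) : ψ (I.mkQ (ev g)) =
      g (∑ i, (ψ (I.mkQ (fun j => if i = j then 1 else 0))) • k i) := by
    have := LinearMap.pi_apply_eq_sum_univ (ψ ∘ₗ I.mkQ) (ev g)
    rw [LinearMap.comp_apply] at this
    rw [this, map_sum]
    refine Finset.sum_congr rfl fun i _ => ?_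
    rw [map_smul, smul_eq_mul, smul_eq_mul, mul_comm]
    rfl
  refine hψ ?_
  rw [h2]
  refine (congrArg f (hW _ fun g hg => ?_)).trans (map_zero f)
  rw [← h2, Submodule.mkQ_apply, (Submodule.Quotient.mk_eq_zero I).2 ⟨g, hg, rfl⟩, map_zero]

theorem IsDenseIn.trans {N : Type*} [AddCommGroup N] [Module R N] {S T W : Set (H →ₗ[R] N)}
    (h1 : IsDenseIn S T) (h2 : IsDenseIn T W) : IsDenseIn S W := by
  rw [isDenseIn_iff] at *
  intro f hf F
  obtain ⟨g, hg, hgf⟩ := h2 f hf F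
  obtain ⟨g', hg', hg'g⟩ := h1 g hg F
  exact ⟨g', hg', fun x hx => (hg'g x hx).trans (hgf x hx)⟩

end PurityUniverse

end

end HopfDuality

open HopfDuality in
theorem mainTheorem11 {R : Type*} {H : Type*} {A : Type*} [CommRing R] [Ring H]
    [HopfAlgebra R H] [Module.Projective R H] [Ring A] [Algebra R A]
    (ω : HopfDuality.WeakAction R H A) (σ : HopfDuality.InvertibleCochain R H A)
    (hσ : HopfDuality.IsCrossedProduct ω σ.map)
    (U : HopfDuality.LeftModuleSubalgebra R H)
    (V : Submodule R (Module.Dual R H))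
    (hVU : HopfDuality.IsCompatible ω σ V U.toSubmodule) :
    (HopfDuality.IsDenseIn (U.toSubmodule : Set (Module.Dual R H)) Set.univ →
      Function.Injective (HopfDuality.alphaMap U.toSubmodule (A ⊗[R] H)) →
      HopfDuality.HasDenseDuality ω σ U) ∧
    (IsNoetherianRing R →
      HopfDuality.IsPureFor (HopfDuality.toFunctions U.toSubmodule) A →
      Function.Injective (HopfDuality.alphaMap U.toSubmodule (A ⊗[R] H))) ∧
    (∀ [HopfDuality.IsQuasiFrobenius R],
      HopfDuality.IsAlphaAlgebra R H →
      HopfDuality.IsResiduallyFinite R H →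
      HopfDuality.IsSubbialgebra U.toSubmodule →
      HopfDuality.IsDenseIn (U.toSubmodule : Set (Module.Dual R H))
        (HopfDuality.finiteDual R H : Set (Module.Dual R H)) →
      HopfDuality.IsDenseIn (U.toSubmodule : Set (Module.Dual R H)) Set.univ ∧
      Function.Injective (HopfDuality.alphaMap U.toSubmodule (A ⊗[R] H)) ∧
      HopfDuality.HasDenseDuality ω σ U) := by
  refine ⟨hasDenseDuality hσ hVU, fun _ hU => alphaMap_tensor_injective hU, ?_⟩
  intro _ hα hr hU hd
  -- Residual finiteness says precisely that `H°` separates the points of `H`.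
  have hdense := hd.trans (isDenseIn_of_separates (finiteDual R H) fun k hk =>
    hr (LinearMap.ext fun f => (hk f.1 f.2).trans (map_zero f.1).symm))
  have hinj := alphaMap_injective_of_isPure (isPure_toFunctions_of_le _ hU.pure hα) (A ⊗[R] H)
  exact ⟨hdense, hinj, hasDenseDuality hσ hVU hdense hinj⟩
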